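/- Conventions. Let $\mathbb{H}^3$ be hyperbolic three-space of curvature $-1$ with distance $\operatorname{dist}$, and for a surface with unit normal $\nu$ and principal curvatures $k_1,k_2$ let $H=\frac{k_1+k_2}{2}$ (signed so that geodesic spheres have $H>0$ with respect to the outer normal). A smooth mean curvature flow on $[0,T)$ with initial embedding $F_0:S^2\to\mathbb{H}^3$ is a smooth map $F:S^2\times[0,T)\to\mathbb{H}^3$ such that every $F(\cdot,t)$ is an immersion, $F(\cdot,0)=F_0$ and $\partial_tF=-H\nu$; write $M_t=F(S^2,t)$, with area taken in the hyperbolic metric. The region enclosed by a closed surface $M\subset\mathbb{H}^3$ is the union of the bounded connected components of $\mathbb{H}^3\setminus M$. For $p,q\in\mathbb{H}^3$ and $\varepsilon>0$, the surface $M$ is called a dumbbell about $p$ and $q$ of thickness $\varepsilon$ if (i) $M$ encloses the two closed geodesic unit balls centred at $p$ and $q$; (ii) the region enclosed by $M$ is contained in the union of the open geodesic balls of radius $1+\varepsilon$ centred at $p$ and $q$ and the open $\varepsilon$-neighbourhood of the geodesic segment from $p$ to $q$; (iii) $M$ is invariant under all isometries of $\mathbb{H}^3$ that fix $p$ and $q$.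 Theorem 6.1. There is $d_0$ such that for every $d\ge d_0$ and every $\varepsilon>0$ there are points $p,q\in\mathbb{H}^3$ with $\operatorname{dist}(p,q)=d$ and a smoothly embedded sphere $M_0=F_0(S^2)\subset\mathbb{H}^3$ which is a dumbbell about $p$ and $q$ of thickness $\varepsilon$ and which must develop a singularity under mean curvature flow before its area decreases to zero, in the following sense: there are constants $T_1<\infty$ and $c>0$ such that every smooth mean curvature flow on $[0,T)$, $T>0$, with initial embedding $F_0$ satisfies $$T\le T_1\qquad\text{and}\qquad \operatorname{Area}(M_t)\ge c\quad\text{for all }t\in[0,T).$$ (So the flow cannot be continued smoothly beyond the time $T_1$, and as long as it is smooth its area stays bounded away from zero.) -/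

import Mathlib

open Set MeasureTheory Metric
open scoped Manifold ContDiff

noncomputable section

/-- Euclidean three-space. -/
abbrev E3 : Type := EuclideanSpace ℝ (Fin 3)

/-- The round unit sphere `S²`, with Mathlib's smooth structure. -/
abbrev S2 : Type := sphere (0 : E3) 1

instance factFinrankE3 : Fact (Module.finrank ℝ E3 = 2 + 1) := ⟨by simp⟩

/-- The vector space underlying Minkowski space `ℝ^{1,3}` (time coordinate first). -/
abbrev Mink : Type := ℝ × E3

/-- The Lorentz form of signature `(-,+,+,+)`. -/
def mink (X Y : Mink) : ℝ := inner ℝ X.2 Y.2 - X.1 * Y.1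

/-- Hyperbolic three-space `ℍ³` (curvature `-1`) in the hyperboloid model: the future sheet of
`⟨X, X⟩ = -1`. Its Riemannian metric is the restriction of `mink` to the tangent spaces. -/
def H3 : Set Mink := {X | mink X X = -1 ∧ 0 < X.1}

/-- The hyperbolic distance: `cosh (hdist X Y) = -⟨X, Y⟩` for `X, Y` in `ℍ³`. -/
def hdist (X Y : Mink) : ℝ := Real.arcosh (-mink X Y)

/-- The open geodesic ball of `ℍ³`. -/
def hball (p : Mink) (r : ℝ) : Set Mink := {X | X ∈ H3 ∧ hdist p X < r}

/-- The closed geodesic ball of `ℍ³`. -/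
def hclosedBall (p : Mink) (r : ℝ) : Set Mink := {X | X ∈ H3 ∧ hdist p X ≤ r}

/-- The geodesic segment of `ℍ³` with end points `p` and `q`. -/
def hsegment (p q : Mink) : Set Mink := {Z | Z ∈ H3 ∧ hdist p Z + hdist Z q = hdist p q}

/-- The open tube of radius `r` about the geodesic segment from `p` to `q`. -/
def htube (p q : Mink) (r : ℝ) : Set Mink := {X | X ∈ H3 ∧ ∃ Z ∈ hsegment p q, hdist X Z < r}

/-- The region of `ℍ³` enclosed by `M`: the union of the bounded connected components of
`ℍ³ \ M`. (The topology of `ℍ³` is the subspace topology.) -/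
def enclosed (M : Set Mink) : Set Mink :=
  {X | X ∈ H3 \ M ∧ ∃ R : ℝ, ∀ Y ∈ connectedComponentIn (H3 \ M) X, hdist X Y ≤ R}

/-! ### Geometry of maps of the sphere into `ℍ³` -/

/-- The degree-zero homogeneous extension `y ↦ f (y / |y|)` of a map on `S²` to `ℝ³ \ {0}`
(with the value `0` at the origin, which plays no role). Its derivatives at `x ∈ S²` in
directions tangent to `S²` are the derivatives of `f` in the local parametrization
`u ↦ (x + u) / |x + u|`, `u ⟂ x`, of `S²` around `x`. -/
def homExt (f : S2 → Mink) (y : E3) : Mink :=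
  if hy : y ≠ 0 then f ⟨‖y‖⁻¹ • y, by simp [norm_smul, hy]⟩ else 0

/-- An orthonormal basis of the tangent plane `x^⟂` of `S²` at `x`. The quantities `areaDensity`
and `meanCurvature` below do not depend on which one is used. -/
def frame (x : S2) (i : Fin 2) : E3 :=
  (OrthonormalBasis.fromOrthogonalSpanSingleton (𝕜 := ℝ) 2
    (ne_zero_of_mem_unit_sphere x) i : E3)

/-- The tangent vector `∂ᵢ f` at `x`. -/
def tangentVec (f : S2 → Mink) (x : S2) (i : Fin 2) : Mink :=
  fderiv ℝ (homExt f) (x : E3) (frame x i)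

/-- The second derivative `∂ᵢ ∂ⱼ f` at `x`. -/
def secondDeriv (f : S2 → Mink) (x : S2) (i j : Fin 2) : Mink :=
  fderiv ℝ (fun y => fderiv ℝ (homExt f) y (frame x j)) (x : E3) (frame x i)

/-- The first fundamental form `gᵢⱼ = ⟨∂ᵢ f, ∂ⱼ f⟩`. -/
def firstForm (f : S2 → Mink) (x : S2) : Matrix (Fin 2) (Fin 2) ℝ :=
  Matrix.of fun i j => mink (tangentVec f x i) (tangentVec f x j)

/-- `ν` is a unit normal vector at `f x` of the surface `f` in `ℍ³`: it is tangent to `ℍ³`,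
orthogonal to the surface, and of length one. -/
def IsUnitNormal (f : S2 → Mink) (x : S2) (ν : Mink) : Prop :=
  mink ν (f x) = 0 ∧ (∀ i, mink ν (tangentVec f x i) = 0) ∧ mink ν ν = 1

/-- The second fundamental form `hᵢⱼ = -⟨∇ᵢ ∂ⱼ f, ν⟩` with respect to the unit normal `ν`, with
the sign for which geodesic spheres are positively curved with respect to the outer normal.
The Levi-Civita derivative `∇` of `ℍ³` is the tangential part of the flat one, so it may be
replaced by the flat derivative here because `ν` is tangent to `ℍ³`. -/
def secondForm (f : S2 → Mink) (x : S2) (ν : Mink) : Matrix (Fin 2) (Fin 2) ℝ :=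
  Matrix.of fun i j => -mink (secondDeriv f x i j) ν

/-- The mean curvature `H = (k₁ + k₂) / 2 = (1/2) gⁱʲ hᵢⱼ` with respect to `ν`. -/
def meanCurvature (f : S2 → Mink) (x : S2) (ν : Mink) : ℝ :=
  (1 / 2) * ((firstForm f x)⁻¹ * secondForm f x ν).trace

/-- The Jacobian of `f` at `x`, relative to the round metric of `S²`. -/
def areaDensity (f : S2 → Mink) (x : S2) : ℝ := Real.sqrt (firstForm f x).det

/-- The hyperbolic area of the surface `f`; `volume.toSphere` is the round area measure of `S²`
(of total mass `4π`). -/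
def area (f : S2 → Mink) : ℝ := ∫ x, areaDensity f x ∂(volume : Measure E3).toSphere

/-- `f` is a smooth immersion of `S²` into `ℍ³`. -/
structure IsSmoothImmersion (f : S2 → Mink) : Prop where
  mem : ∀ x, f x ∈ H3
  smooth : ContMDiff (𝓡 2) 𝓘(ℝ, Mink) ∞ f
  immersion : ∀ x, Function.Injective (mfderiv (𝓡 2) 𝓘(ℝ, Mink) f x)

/-- `f` is a smooth embedding of (the compact surface) `S²` into `ℍ³`. -/
structure IsSmoothEmbedding (f : S2 → Mink) : Prop extends IsSmoothImmersion f where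
  injective : Function.Injective f

/-- `F` is a smooth mean curvature flow of spheres in `ℍ³` on the time interval `[0, T)` with
initial surface `F₀`: `F` is smooth on `[0, T) × S²`, every `F t` is an immersion into `ℍ³`,
`F 0 = F₀` and `∂ₜ F = -H ν`. (The vector `H ν` does not change when `ν` is replaced by `-ν`,
so that `ν` may be taken to be the outer unit normal or its opposite.) -/
structure IsMCF (F₀ : S2 → Mink) (F : ℝ → S2 → Mink) (T : ℝ) : Prop where
  smooth : ContMDiffOn (𝓘(ℝ, ℝ).prod (𝓡 2)) 𝓘(ℝ, Mink) ∞
    (fun z : ℝ × S2 => F z.1 z.2) (Ico 0 T ×ˢ univ)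
  immersion : ∀ t ∈ Ico 0 T, IsSmoothImmersion (F t)
  initial : F 0 = F₀
  evolution : ∀ t ∈ Ico 0 T, ∀ x, ∃ ν, IsUnitNormal (F t) x ν ∧
    HasDerivWithinAt (fun s => F s x) (-(meanCurvature (F t) x ν • ν)) (Ico 0 T) t

/-- The surface `M ⊂ ℍ³` is a dumbbell about `p` and `q` of thickness `ε`: it encloses the two
closed unit balls with centres `p` and `q`; the region it encloses lies in the union of the
two balls of radius `1 + ε` and of the tube of radius `ε` about the geodesic segment from `p`
to `q`; and it is a surface of revolution, that is, it is invariant under all isometries of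
`ℍ³` (restrictions of linear Lorentz transformations) that fix `p` and `q`. -/
structure IsDumbbell (M : Set Mink) (p q : Mink) (ε : ℝ) : Prop where
  ball_left : hclosedBall p 1 ⊆ enclosed M
  ball_right : hclosedBall q 1 ⊆ enclosed M
  thin : enclosed M ⊆ hball p (1 + ε) ∪ hball q (1 + ε) ∪ htube p q ε
  revolution : ∀ L : Mink ≃ₗ[ℝ] Mink, (∀ X Y, mink (L X) (L Y) = mink X Y) →
    L p = p → L q = q → L '' M = M

end

/-! Two barriers race against each other. Since `H` is half the trace of the second fundamental
form, the flow reads `∂ₜF = ½ ΔF - F` in Minkowski space. Hence, at a spatial maximum of `φ ∘ F`,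
the time derivative is bounded by flat first and second derivatives of `φ`
(`deriv_mean_curvature_le`), and a maximum principle applies (`le_of_deriv_nonpos_at_maxima`).

For `φ = ⟨·, p⟩` the maximum of `eᵗ φ` does not increase (`IsMCF.exp_mul_mink_le`). So a surface
that starts outside the unit balls about `p` and `q` stays off smaller balls about both centres up
to time `1/4`. For `φ = neckBarrier`, that is `sinh²` of the distance to the axis minus `¼ log (1 +
u²)` with `u = X.2 2`, the maximum falls at speed at least `1/4` (`IsMCF.neckBarrier_le`). This `φ`
is nonnegative on the plane `u = 0`; if it starts at most `1/32`, the surface has left that plane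
after time `1/8`. The logarithm slows the barrier only by a bounded amount, yet it is unbounded, so
unit balls fit below the barrier once they are far enough apart. This fixes `d₀` independently of
`ε`.

Topology contradicts survival beyond `1/8`. While the flow avoids `p`, it stays homotopic to the
round sphere in the complement of `p` and therefore meets every ray from `p`; likewise for `q`
(`IsMCF.exists_mem_ray`). Rays pointing away from the plane give points on both of its sides, and
connectedness of `S²` gives a point on it. Hence `T ≤ 1/8`. Up to then the rays parallel to the axis
from all points near `p` meet the surface, so its projection along the axis covers a fixed disc,
which bounds the area from below (`area_ge_of_projection`).

The statement about rays rests on `no_smooth_retraction`, proved by integrating Jacobians. The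
initial surface (`exists_dumbbell`) is explicit: slightly enlarged geodesic spheres, joined by a
neck as thin as desired. -/

noncomputable section

/-! ### A smooth retraction of a ball onto its boundary sphere does not exist -/

/-- The matrix of an endomorphism of `ℝ³` in the standard basis. -/
def stdMatrix (A : E3 →L[ℝ] E3) : Matrix (Fin 3) (Fin 3) ℝ :=
  Matrix.of fun i j => A (EuclideanSpace.single j 1) i

lemma det_eq_det_stdMatrix (A : E3 →L[ℝ] E3) : A.det = (stdMatrix A).det := by
  rw [ContinuousLinearMap.det, ← LinearMap.det_toMatrix (EuclideanSpace.basisFun (Fin 3) ℝ).toBasis]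
  congr 1

/-- The sum of the principal minors of size two. -/
def minorSum (M : Matrix (Fin 3) (Fin 3) ℝ) : ℝ :=
  (M 0 0 * M 1 1 - M 0 1 * M 1 0) + (M 0 0 * M 2 2 - M 0 2 * M 2 0)
    + (M 1 1 * M 2 2 - M 1 2 * M 2 1)

/-- Makes the Jacobian of `y ↦ y + s • G y` a cubic polynomial in `s`, so that its integral over a
ball is determined for all `s` by small `s`. -/
lemma det_id_add_smul (A : E3 →L[ℝ] E3) (s : ℝ) :
    (ContinuousLinearMap.id ℝ E3 + s • A).det =
      1 + s * (stdMatrix A).trace + s ^ 2 * minorSum (stdMatrix A) + s ^ 3 * A.det := by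
  have : stdMatrix (ContinuousLinearMap.id ℝ E3 + s • A) = 1 + s • stdMatrix A := by
    ext i j
    simp [stdMatrix, Matrix.one_apply]
  rw [det_eq_det_stdMatrix, det_eq_det_stdMatrix A, this]
  simp [Matrix.det_fin_three, Matrix.trace_fin_three, minorSum]
  ring

/-- A smooth displacement of the ball vanishing on its boundary, extended by zero, is Lipschitz. -/
lemma lipschitzWith_indicator_ball {G : E3 → E3} {C : NNReal} {R : ℝ}
    (hG : LipschitzOnWith C G (closedBall 0 R)) (h0 : ∀ y, ‖y‖ = R → G y = 0) :
    LipschitzWith C ((closedBall (0 : E3) R).indicator G) := by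
  -- A segment from inside to outside crosses the sphere, where `G` vanishes, and the crossing point
  -- is no farther from `y` than `z` is.
  have mixed : ∀ y z : E3, ‖y‖ ≤ R → R < ‖z‖ → dist (G y) 0 ≤ C * dist y z := by
    intro y z hy hz
    have hc : ContinuousOn (fun t : ℝ => ‖AffineMap.lineMap (k := ℝ) y z t‖) (Icc 0 1) := by
      have : Continuous (AffineMap.lineMap (k := ℝ) y z) := AffineMap.lineMap_continuous
      exact this.norm.continuousOn
    obtain ⟨t, ht, htR⟩ := intermediate_value_Icc zero_le_one hc
      (show R ∈ Icc _ _ by simpa using ⟨hy, hz.le⟩)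
    have htR : ‖AffineMap.lineMap (k := ℝ) y z t‖ = R := htR
    rw [← h0 _ htR]
    refine (hG.dist_le_mul _ (by simpa using hy) _ (by simpa using htR.le)).trans ?_
    gcongr
    rw [dist_left_lineMap, Real.norm_of_nonneg ht.1]
    exact mul_le_of_le_one_left dist_nonneg ht.2
  refine LipschitzWith.of_dist_le_mul fun y z => ?_
  by_cases hy : y ∈ closedBall (0 : E3) R <;> by_cases hz : z ∈ closedBall (0 : E3) R
  · simpa [hy, hz] using hG.dist_le_mul y hy z hz
  · rw [indicator_of_mem hy, indicator_of_notMem hz]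
    exact mixed y z (by simpa using hy) (by simpa using hz)
  · rw [indicator_of_notMem hy, indicator_of_mem hz, dist_comm, dist_comm y]
    exact mixed z y (by simpa using hz) (by simpa using hy)
  · rw [indicator_of_notMem hy, indicator_of_notMem hz, dist_self]
    positivity

/-- A small Lipschitz perturbation of the identity is bijective. -/
lemma bijective_id_add {g : E3 → E3} {c : NNReal} (hc : c < 1) (hg : LipschitzWith c g) :
    Function.Bijective fun y => y + g y := by
  constructor
  · intro y z h
    have h1 : y - z = g z - g y := by
      have : y + g y = z + g z := h
      rw [sub_eq_sub_iff_add_eq_add, this, add_comm]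
    have h2 : dist y z ≤ c * dist y z := by
      conv_lhs => rw [dist_eq_norm, h1, ← dist_eq_norm, dist_comm]
      exact hg.dist_le_mul y z
    have h3 : (c : ℝ) < 1 := by exact_mod_cast hc
    have : dist y z = 0 := by nlinarith [dist_nonneg (x := y) (y := z)]
    exact dist_eq_zero.1 this
  · intro z
    have hk : ContractingWith c fun y => z - g y := by
      refine ⟨hc, LipschitzWith.of_dist_le_mul fun a b => ?_⟩
      rw [dist_sub_left]
      exact hg.dist_le_mul a b
    refine ⟨hk.fixedPoint, ?_⟩
    have := hk.fixedPoint_isFixedPt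
    have h : z - g hk.fixedPoint = hk.fixedPoint := this
    show hk.fixedPoint + g hk.fixedPoint = z
    nth_rewrite 1 [← h]
    simp

/-- Differentiating `|f|² = R²` shows that the range of the derivative is orthogonal to `f y ≠ 0`,
so the derivative is not surjective. -/
lemma det_fderiv_eq_zero_of_norm_const {f : E3 → E3} {R : ℝ} (hR : 0 < R) {y : E3}
    (hf : DifferentiableAt ℝ f y) (h : ∀ᶠ z in nhds y, ‖f z‖ = R) : (fderiv ℝ f y).det = 0 := by
  by_contra hdet
  have hperp : ∀ v, inner ℝ (f y) (fderiv ℝ f y v) = 0 := by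
    intro v
    have h1 : HasFDerivAt (fun z => inner ℝ (f z) (f z)) _ y :=
      hf.hasFDerivAt.inner ℝ hf.hasFDerivAt
    have h2 : (fun z => inner ℝ (f z) (f z)) =ᶠ[nhds y] fun _ => R ^ 2 := by
      filter_upwards [h] with z hz
      rw [real_inner_self_eq_norm_sq, hz]
    have h3 := h1.unique ((hasFDerivAt_const (R ^ 2) y).congr_of_eventuallyEq h2)
    have h4 := congrArg (fun l => l v) h3
    simp only [ContinuousLinearMap.comp_apply, ContinuousLinearMap.prod_apply,
      fderivInnerCLM_apply, zero_apply] at h4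
    rw [real_inner_comm] at h4
    linarith [real_inner_comm (f y) (fderiv ℝ f y v)]
  have hsurj : Function.Surjective (fderiv ℝ f y) := by
    have hu : IsUnit (LinearMap.det (fderiv ℝ f y : E3 →ₗ[ℝ] E3)) := isUnit_iff_ne_zero.2 hdet
    exact (LinearEquiv.ofIsUnitDet (f := (fderiv ℝ f y : E3 →ₗ[ℝ] E3))
      (v := (EuclideanSpace.basisFun (Fin 3) ℝ).toBasis)
      (v' := (EuclideanSpace.basisFun (Fin 3) ℝ).toBasis)
      (by rwa [LinearMap.det_toMatrix])).surjective
  obtain ⟨v, hv⟩ := hsurj (f y)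
  have := hperp v
  rw [hv, inner_self_eq_zero] at this
  have h5 := h.self_of_nhds
  rw [this, norm_zero] at h5
  exact hR.ne h5

/-- With `G = f - id`, the map `id + s G` is for small `s` a bijection of the ball onto itself, so
the integral of its Jacobian is the volume of the ball. This integral is polynomial in `s`, hence
equals the volume at `s = 1` too; but there the map is `f`, which takes values in a sphere and has
zero Jacobian. -/
theorem no_smooth_retraction {f : E3 → E3} (hf : ContDiff ℝ 1 f) {R : ℝ} (hR : 0 < R)
    (h1 : ∀ y, ‖y‖ ≤ R → ‖f y‖ = R) (h2 : ∀ y, ‖y‖ = R → f y = y) : False := by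
  set G : E3 → E3 := fun y => f y - y with hGdef
  have hG : ContDiff ℝ 1 G := hf.sub contDiff_id
  have hdG : Continuous (fderiv ℝ G) := hG.continuous_fderiv one_ne_zero
  have hcpt : IsCompact (closedBall (0 : E3) R) := isCompact_closedBall 0 R
  obtain ⟨C, hC⟩ : ∃ C : NNReal, LipschitzOnWith C G (closedBall 0 R) := by
    obtain ⟨C, hC⟩ := hcpt.exists_bound_of_continuousOn hdG.continuousOn
    refine ⟨⟨max C 0, le_max_right _ _⟩, (convex_closedBall 0 R).lipschitzOnWith_of_nnnorm_fderiv_le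
      (fun y _ => (hG.differentiable one_ne_zero) y) fun y hy => ?_⟩
    exact (hC y hy).trans (le_max_left _ _)
  have hLip := lipschitzWith_indicator_ball hC fun y hy => by simp [hGdef, h2 y hy]
  have hent : ∀ i j, Continuous fun y => stdMatrix (fderiv ℝ G y) i j := by
    intro i j
    have : Continuous fun y => fderiv ℝ G y (EuclideanSpace.single j 1) :=
      hdG.clm_apply continuous_const
    exact (PiLp.continuous_apply 2 _ i).comp this
  have hc1 : Continuous fun y => (stdMatrix (fderiv ℝ G y)).trace := by
    simp only [Matrix.trace_fin_three]
    exact ((hent 0 0).add (hent 1 1)).add (hent 2 2)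
  have hc2 : Continuous fun y => minorSum (stdMatrix (fderiv ℝ G y)) := by
    unfold minorSum
    have := hent
    fun_prop
  have hc3 : Continuous fun y => (fderiv ℝ G y).det := by
    simp only [det_eq_det_stdMatrix, Matrix.det_fin_three]
    have := hent
    fun_prop
  obtain ⟨K1, hK1⟩ := hcpt.exists_bound_of_continuousOn hc1.continuousOn
  obtain ⟨K2, hK2⟩ := hcpt.exists_bound_of_continuousOn hc2.continuousOn
  obtain ⟨K3, hK3⟩ := hcpt.exists_bound_of_continuousOn hc3.continuousOn
  have h0B : (0 : E3) ∈ closedBall (0 : E3) R := by simp [hR.le]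
  have hK1n := (norm_nonneg _).trans (hK1 0 h0B)
  have hK2n := (norm_nonneg _).trans (hK2 0 h0B)
  have hK3n := (norm_nonneg _).trans (hK3 0 h0B)
  have hder : ∀ (s : ℝ) (y : E3), HasFDerivAt (fun y => y + s • G y)
      (ContinuousLinearMap.id ℝ E3 + s • fderiv ℝ G y) y := fun s y =>
    (hasFDerivAt_id y).fun_add (((hG.differentiable one_ne_zero) y).hasFDerivAt.fun_const_smul s)
  set B := ball (0 : E3) R with hB
  have hI : ∀ (φ : E3 → ℝ), Continuous φ → IntegrableOn φ B := fun φ hφ =>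
    (hφ.continuousOn.integrableOn_compact hcpt).mono_set ball_subset_closedBall
  set V : ℝ := volume.real B with hV
  -- For `s < s₀` both `s C < 1`, so that the perturbation is a contraction, and `s (K1 + K2 + K3) <
  -- 1`, so that the Jacobian is nonnegative.
  set s₀ : ℝ := 1 / (1 + C + (K1 + K2 + K3)) with hs₀
  have hCn : (0 : ℝ) ≤ C := C.2
  have hden : 0 < 1 + (C : ℝ) + (K1 + K2 + K3) := by positivity
  have hs₀pos : 0 < s₀ := by positivity
  -- the polynomial `s ↦ ∫ det (1 + s DG)` is constant for small `s`
  have key : ∀ s, 0 < s → s < s₀ →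
      s * (∫ y in B, (stdMatrix (fderiv ℝ G y)).trace)
        + s ^ 2 * (∫ y in B, minorSum (stdMatrix (fderiv ℝ G y)))
        + s ^ 3 * (∫ y in B, (fderiv ℝ G y).det) = 0 := by
    intro s hs hss
    have hs1 : s * (1 + C + (K1 + K2 + K3)) < 1 := by
      rwa [hs₀, lt_div_iff₀ hden] at hss
    have hsle : s ≤ 1 := by nlinarith
    have hbij : Function.Bijective fun y => y + s • (closedBall (0 : E3) R).indicator G y := by
      have hl : LipschitzWith (s.toNNReal * C)
          (fun y => s • (closedBall (0 : E3) R).indicator G y) := by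
        refine LipschitzWith.of_dist_le_mul fun a b => ?_
        rw [dist_smul₀, Real.norm_of_nonneg hs.le]
        calc _ ≤ s * (C * dist a b) := by gcongr; exact hLip.dist_le_mul a b
          _ = _ := by rw [NNReal.coe_mul, Real.coe_toNNReal s hs.le, mul_assoc]
      refine bijective_id_add (c := s.toNNReal * C) ?_ hl
      rw [← NNReal.coe_lt_coe]
      rw [NNReal.coe_mul, Real.coe_toNNReal s hs.le, NNReal.coe_one]
      nlinarith
    have hon : ∀ y ∈ B, y + s • (closedBall (0 : E3) R).indicator G y = y + s • G y := by
      intro y hy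
      rw [indicator_of_mem (ball_subset_closedBall hy)]
    have hoff : ∀ y ∉ B, y + s • (closedBall (0 : E3) R).indicator G y = y := by
      intro y hy
      by_cases hy' : y ∈ closedBall (0 : E3) R
      · have : ‖y‖ = R := le_antisymm (by simpa using hy') (by simpa [hB] using hy)
        rw [indicator_of_mem hy', hGdef]
        simp [h2 y this]
      · simp [hy']
    -- The extended map is a bijection of the whole space and the identity off `B`, hence it maps
    -- `B` onto itself.
    have himg : (fun y => y + s • G y) '' B = B := by
      rw [← image_congr hon]
      have hcompl : (fun y => y + s • (closedBall (0 : E3) R).indicator G y) '' Bᶜ = Bᶜ := by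
        rw [image_congr (s := Bᶜ) (g := id) hoff, image_id]
      rw [← compl_inj_iff, ← image_compl_eq hbij, hcompl]
    have hinj : InjOn (fun y => y + s • G y) B := by
      intro a ha b hb hab
      have hab : a + s • G a = b + s • G b := hab
      rw [← hon a ha, ← hon b hb] at hab
      exact hbij.1 hab
    have hpos : ∀ y ∈ B, 0 ≤ (ContinuousLinearMap.id ℝ E3 + s • fderiv ℝ G y).det := by
      intro y hy
      have hy' := ball_subset_closedBall hy
      rw [det_id_add_smul]
      have a1 := abs_le.1 (hK1 y hy')
      have a2 := abs_le.1 (hK2 y hy')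
      have a3 := abs_le.1 (hK3 y hy')
      have b2 : s ^ 2 ≤ s := by nlinarith
      have b3 : s ^ 3 ≤ s := by nlinarith [sq_nonneg s]
      have c1 : -(s * K1) ≤ s * (stdMatrix (fderiv ℝ G y)).trace := by nlinarith
      have c2 : -(s * K2) ≤ s ^ 2 * minorSum (stdMatrix (fderiv ℝ G y)) := by
        nlinarith [sq_nonneg s, mul_le_mul_of_nonneg_right b2 hK2n]
      have c3 : -(s * K3) ≤ s ^ 3 * (fderiv ℝ G y).det := by
        nlinarith [pow_pos hs 3, mul_le_mul_of_nonneg_right b3 hK3n]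
      nlinarith
    have hint := integral_image_eq_integral_abs_det_fderiv_smul volume
      (measurableSet_ball (x := (0 : E3)) (ε := R)) (fun y _ => (hder s y).hasFDerivWithinAt) hinj
      (fun _ => (1 : ℝ))
    rw [show ball (0 : E3) R = B from rfl, himg] at hint
    rw [setIntegral_congr_fun (measurableSet_ball (x := (0 : E3)) (ε := R))
      (f := fun y => |(ContinuousLinearMap.id ℝ E3 + s • fderiv ℝ G y).det| • (1 : ℝ))
      (g := fun y => 1 + s * (stdMatrix (fderiv ℝ G y)).trace
        + s ^ 2 * minorSum (stdMatrix (fderiv ℝ G y)) + s ^ 3 * (fderiv ℝ G y).det)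
      (fun y hy => by
        simp only [smul_eq_mul, mul_one]
        rw [abs_of_nonneg (hpos y hy), det_id_add_smul])] at hint
    rw [integral_add, integral_add, integral_add, integral_const_mul, integral_const_mul,
      integral_const_mul] at hint
    · linarith
    · exact hI _ continuous_const
    · exact hI _ (continuous_const.mul hc1)
    · exact hI _ (continuous_const.add (continuous_const.mul hc1))
    · exact hI _ (continuous_const.mul hc2)
    · exact hI _ ((continuous_const.add (continuous_const.mul hc1)).add (continuous_const.mul hc2))
    · exact hI _ (continuous_const.mul hc3)
  set J1 := ∫ y in B, (stdMatrix (fderiv ℝ G y)).trace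
  set J2 := ∫ y in B, minorSum (stdMatrix (fderiv ℝ G y))
  set J3 := ∫ y in B, (fderiv ℝ G y).det
  have hsum : J1 + J2 + J3 = 0 := by
    -- A quadratic polynomial with three distinct zeros vanishes identically; the zeros used are
    -- `s₀/2`, `s₀/3`, `s₀/4`.
    have e : ∀ s, 0 < s → s < s₀ → J1 + s * J2 + s ^ 2 * J3 = 0 := by
      intro s hs hss
      have := key s hs hss
      have h : s * (J1 + s * J2 + s ^ 2 * J3) = 0 := by linarith
      exact (mul_eq_zero.1 h).resolve_left hs.ne'
    have e1 := e (s₀ / 2) (by positivity) (by linarith)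
    have e2 := e (s₀ / 3) (by positivity) (by linarith)
    have e3 := e (s₀ / 4) (by positivity) (by linarith)
    have f1 : s₀ * (J2 / 6 + s₀ * (5 / 36) * J3) = 0 := by linarith
    have f2 : s₀ * (J2 / 12 + s₀ * (7 / 144) * J3) = 0 := by linarith
    have g1 := (mul_eq_zero.1 f1).resolve_left hs₀pos.ne'
    have g2 := (mul_eq_zero.1 f2).resolve_left hs₀pos.ne'
    have g3 : s₀ * J3 = 0 := by linarith
    have hJ3 := (mul_eq_zero.1 g3).resolve_left hs₀pos.ne'
    have hJ2 : J2 = 0 := by rw [hJ3] at g1; linarith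
    rw [hJ2, hJ3] at e1
    rw [hJ2, hJ3]
    linarith
  have hfin : (0 : ℝ) = V + J1 + J2 + J3 := by
    have hz : ∀ y ∈ B, (0 : ℝ) = 1 + (stdMatrix (fderiv ℝ G y)).trace
        + minorSum (stdMatrix (fderiv ℝ G y)) + (fderiv ℝ G y).det := by
      intro y hy
      have hd : (fderiv ℝ f y).det = 0 := by
        refine det_fderiv_eq_zero_of_norm_const hR ((hf.differentiable one_ne_zero) y) ?_
        filter_upwards [isOpen_ball.mem_nhds hy] with z hz
        exact h1 z (by simpa using (ball_subset_closedBall hz))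
      have hfe : fderiv ℝ f y = ContinuousLinearMap.id ℝ E3 + (1 : ℝ) • fderiv ℝ G y := by
        have := (hder 1 y).fderiv
        rw [← this]
        congr 1
        ext1 z
        simp [hGdef]
      rw [hfe, det_id_add_smul] at hd
      linarith
    have := setIntegral_congr_fun (measurableSet_ball (x := (0 : E3)) (ε := R)) (μ := volume)
      (f := fun _ => (0 : ℝ)) hz
    rw [integral_add, integral_add, integral_add] at this
    · simpa using this
    · exact hI _ continuous_const
    · exact hI _ hc1
    · exact hI _ (continuous_const.add hc1)
    · exact hI _ hc2
    · exact hI _ ((continuous_const.add hc1).add hc2)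
    · exact hI _ hc3
  have hVpos : 0 < V := by
    rw [hV, measureReal_def]
    exact ENNReal.toReal_pos (measure_ball_pos volume _ hR).ne' measure_ball_lt_top.ne
  linarith

/-! ### Maps of `S²` homotopic to the inclusion in `ℝ³ \ {0}` meet every ray -/

/-- A continuous map of `ℝ³` that is the identity off the unit ball has a zero. -/
theorem exists_zero_of_eq_id_off_ball {K : E3 → E3} (hK : Continuous K)
    (h1 : ∀ y, 1 ≤ ‖y‖ → K y = y) : ∃ y, K y = 0 := by
  by_contra! hne
  obtain ⟨m, hm, hmK⟩ : ∃ m > 0, ∀ y, m ≤ ‖K y‖ := by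
    obtain ⟨y₀, -, hy₀⟩ := (isCompact_closedBall (0 : E3) 1).exists_isMinOn ⟨0, by simp⟩
      hK.norm.continuousOn
    refine ⟨min ‖K y₀‖ 1, lt_min (norm_pos_iff.2 (hne y₀)) one_pos, fun y => ?_⟩
    by_cases hy : ‖y‖ ≤ 1
    · exact (min_le_left _ _).trans (hy₀ (by simpa using hy))
    · rw [h1 y (not_le.1 hy).le]
      exact (min_le_right _ _).trans (not_le.1 hy).le
  set g : E3 → E3 := fun y => K y - y with hg
  have hgc : Continuous g := hK.sub continuous_id
  have hgs : HasCompactSupport g := by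
    refine HasCompactSupport.intro (isCompact_closedBall (0 : E3) 1) fun y hy => ?_
    simp only [mem_closedBall, dist_zero_right, not_le] at hy
    simp [hg, h1 y hy.le]
  obtain ⟨δ, hδ, hgδ⟩ := Metric.uniformContinuous_iff.1
    (hgs.uniformContinuous_of_continuous hgc) (m / 2) (by positivity)
  -- Mollifying at scale `η ≤ δ` moves `g` by at most `m / 2`, too little to create a zero of `y + g
  -- y`; `η ≤ 1` keeps the mollified displacement zero for `‖y‖ ≥ 2`. Normalising to length `2` then
  -- gives a forbidden retraction.
  set η := min δ 1 with hη
  have hηpos : 0 < η := lt_min hδ one_pos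
  let φ : ContDiffBump (0 : E3) := ⟨η / 2, η, by positivity, by linarith⟩
  set gs := convolution (φ.normed volume) g (ContinuousLinearMap.lsmul ℝ ℝ) volume with hgs'
  have hgsd : ContDiff ℝ 1 gs :=
    φ.hasCompactSupport_normed.contDiff_convolution_left _ φ.contDiff_normed
      hgc.locallyIntegrable
  have hclose : ∀ y, dist (gs y) (g y) ≤ m / 2 := fun y =>
    φ.dist_normed_convolution_le hgc.aestronglyMeasurable fun x hx =>
      (hgδ (lt_of_lt_of_le (mem_ball.1 hx) (min_le_left _ _))).le
  have hzero : ∀ y, 2 ≤ ‖y‖ → gs y = 0 := by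
    intro y hy
    have hg0 : ∀ x, 1 ≤ ‖x‖ → g x = 0 := fun x hx => by simp [hg, h1 x hx]
    rw [hgs', φ.normed_convolution_eq_right fun x hx => ?_, hg0 y (by linarith)]
    rw [hg0 y (by linarith), hg0 x]
    have h2 : dist x y < 1 := lt_of_lt_of_le (mem_ball.1 hx) (min_le_right _ _)
    have h3 := norm_sub_norm_le y x
    rw [← dist_eq_norm, dist_comm] at h3
    linarith
  have hks : ∀ y, y + gs y ≠ 0 := by
    intro y h0
    have h2 := hclose y
    rw [dist_eq_norm, show gs y = -y from (neg_eq_of_add_eq_zero_right h0).symm] at h2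
    rw [show -y - g y = -K y by simp only [hg]; abel, norm_neg] at h2
    linarith [hmK y]
  have hkd : ContDiff ℝ 1 fun y => y + gs y := contDiff_id.add hgsd
  refine no_smooth_retraction (f := fun y => (2 / ‖y + gs y‖) • (y + gs y)) (R := 2)
    (ContDiff.smul (contDiff_const.div (hkd.norm ℝ hks) fun y => norm_ne_zero_iff.2 (hks y)) hkd)
    two_pos (fun y _ => ?_) fun y hy => ?_
  · rw [norm_smul, norm_div, norm_norm, Real.norm_two,
      div_mul_cancel₀ _ (norm_ne_zero_iff.2 (hks y))]
  · simp [hzero y hy.ge, hy]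

/-- `ℝ³` without the origin. -/
abbrev E3x : Type := {v : E3 // v ≠ 0}

/-- The inclusion of `S²` into `ℝ³ \ {0}`. -/
def sphereIncl : C(S2, E3x) :=
  ⟨fun x => ⟨x, ne_zero_of_mem_unit_sphere x⟩, by fun_prop⟩

/-- The radial projection of `ℝ³ \ {0}` to `S²`, extended by a constant to the origin. -/
def radial (y : E3) : S2 :=
  if hy : y ≠ 0 then ⟨‖y‖⁻¹ • y, by simp [norm_smul, hy]⟩
  else ⟨EuclideanSpace.single 0 1, by simp⟩

lemma coe_radial {y : E3} (hy : y ≠ 0) : (radial y : E3) = ‖y‖⁻¹ • y := by simp [radial, hy]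

lemma continuousAt_radial {y : E3} (hy : y ≠ 0) : ContinuousAt radial y := by
  rw [Topology.IsInducing.subtypeVal.continuousAt_iff]
  have : (fun y : E3 => ‖y‖⁻¹ • y) =ᶠ[nhds y] Subtype.val ∘ radial := by
    filter_upwards [isOpen_ne.mem_nhds hy] with z hz
    exact (coe_radial hz).symm
  refine ContinuousAt.congr ?_ this
  exact ((continuous_norm.continuousAt).inv₀ (norm_ne_zero_iff.2 hy)).smul continuousAt_id

/-- The map `K` is the identity for `‖y‖ ≥ 1`, runs through the homotopy for `1/2 ≤ ‖y‖ ≤ 1`, and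
for `‖y‖ ≤ 1/2` interpolates between `h` and the constant `-e`. It must have a zero. The homotopy
avoids the origin, so the zero lies in the innermost part, where it says that `h` is a positive
multiple of `e`. -/
theorem exists_mem_ray_of_homotopic {h : C(S2, E3x)} (hh : sphereIncl.Homotopic h) {e : E3}
    (he : e ≠ 0) : ∃ x, ∃ s : ℝ, 0 < s ∧ (h x : E3) = s • e := by
  by_contra! hray
  obtain ⟨H⟩ := hh
  set μ : E3 → ℝ := fun y => min (2 * ‖y‖) 1 with hμ
  have hμc : Continuous μ := by fun_prop
  set τ : E3 → unitInterval := fun y => projIcc 0 1 zero_le_one (2 - 2 * ‖y‖) with hτ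
  have hτc : Continuous τ := continuous_projIcc.comp (by fun_prop)
  set Q : E3 → E3 := fun y => (H (τ y, radial y) : E3) with hQ
  set K : E3 → E3 := fun y => (μ y * max 1 ‖y‖) • Q y - (1 - μ y) • e with hKdef
  obtain ⟨C, hC⟩ : ∃ C, ∀ y, ‖Q y‖ ≤ C := by
    have hc : Continuous fun z : unitInterval × S2 => ‖(H z : E3)‖ := by fun_prop
    obtain ⟨C, hC⟩ := (isCompact_range hc).bddAbove
    exact ⟨C, fun y => hC ⟨_, rfl⟩⟩
  have hKc : Continuous K := by
    refine Continuous.sub ?_ (by fun_prop)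
    rw [continuous_iff_continuousAt]
    intro y
    by_cases hy : y = 0
    · subst hy
      have hb : Filter.Tendsto (fun y : E3 => |μ y * max 1 ‖y‖| * C) (nhds 0) (nhds 0) := by
        have : Continuous fun y : E3 => |μ y * max 1 ‖y‖| * C := by fun_prop
        have := this.tendsto 0
        simpa [hμ] using this
      rw [ContinuousAt]
      rw [show (μ 0 * max 1 ‖(0 : E3)‖) • Q 0 = 0 by simp [hμ]]
      refine squeeze_zero_norm (fun y => ?_) hb
      rw [norm_smul]
      exact mul_le_mul_of_nonneg_left (hC y) (norm_nonneg _)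
    · refine ContinuousAt.smul
        (show Continuous fun y => μ y * max 1 ‖y‖ by fun_prop).continuousAt ?_
      have h1 : ContinuousAt (fun y => H (τ y, radial y)) y :=
        H.continuous.continuousAt.comp (hτc.continuousAt.prodMk (continuousAt_radial hy))
      exact continuous_subtype_val.continuousAt.comp h1
  obtain ⟨y, hy⟩ := exists_zero_of_eq_id_off_ball hKc (fun y hy => by
    have hy0 : y ≠ 0 := by rintro rfl; simp at hy; linarith
    have hμ1 : μ y = 1 := min_eq_right (by linarith)
    have hτ0 : τ y = 0 := projIcc_of_le_left _ (by linarith)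
    have hQy : Q y = ‖y‖⁻¹ • y := by
      rw [← coe_radial hy0]
      simp only [hQ, hτ0, H.apply_zero]
      rfl
    simp only [hKdef, hμ1, hQy, max_eq_right hy, one_mul, sub_self, zero_smul, sub_zero]
    rw [smul_smul, mul_inv_cancel₀ (norm_ne_zero_iff.2 hy0), one_smul])
  have hyK : (μ y * max 1 ‖y‖) • Q y = (1 - μ y) • e := sub_eq_zero.1 hy
  have hmax : 0 < max 1 ‖y‖ := lt_max_of_lt_left one_pos
  by_cases hμ1 : μ y = 1
  · rw [hμ1] at hyK
    simp only [one_mul, sub_self, zero_smul, smul_eq_zero] at hyK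
    exact hyK.elim hmax.ne' (H (τ y, radial y)).2
  · have hlt : μ y < 1 := lt_of_le_of_ne (min_le_right _ _) hμ1
    by_cases hμ0 : μ y = 0
    · rw [hμ0] at hyK
      simp at hyK
      exact he hyK.symm
    have hpos : 0 < μ y := lt_of_le_of_ne (le_min (by positivity) zero_le_one) (Ne.symm hμ0)
    have hτ1 : τ y = 1 := by
      refine projIcc_of_right_le _ ?_
      have : 2 * ‖y‖ < 1 := by
        by_contra hcon
        exact hμ1 (min_eq_right (not_lt.1 hcon))
      linarith
    refine hray (radial y) ((μ y * max 1 ‖y‖)⁻¹ * (1 - μ y)) ?_ ?_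
    · have : 0 < 1 - μ y := by linarith
      positivity
    · rw [← smul_smul, ← hyK, smul_smul, inv_mul_cancel₀ (by positivity), one_smul]
      simp [hQ, hτ1]

/-! ### Lorentzian linear algebra -/

lemma mink_comm (X Y : Mink) : mink X Y = mink Y X := by
  simp only [mink, real_inner_comm X.2 Y.2]; ring

lemma mink_add_left (X Y Z : Mink) : mink (X + Y) Z = mink X Z + mink Y Z := by
  simp only [mink, Prod.fst_add, Prod.snd_add, inner_add_left]; ring

lemma mink_smul_left (c : ℝ) (X Y : Mink) : mink (c • X) Y = c * mink X Y := by
  simp only [mink, Prod.smul_fst, Prod.smul_snd, real_inner_smul_left, smul_eq_mul]; ring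

lemma mink_add_right (X Y Z : Mink) : mink X (Y + Z) = mink X Y + mink X Z := by
  rw [mink_comm, mink_add_left, mink_comm Y, mink_comm Z]

lemma mink_smul_right (c : ℝ) (X Y : Mink) : mink X (c • Y) = c * mink X Y := by
  rw [mink_comm, mink_smul_left, mink_comm]

lemma mink_neg_left (X Y : Mink) : mink (-X) Y = -mink X Y := by
  rw [← neg_one_smul ℝ, mink_smul_left]; ring

lemma mink_sub_left (X Y Z : Mink) : mink (X - Y) Z = mink X Z - mink Y Z := by
  rw [sub_eq_add_neg, mink_add_left, mink_neg_left, sub_eq_add_neg]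

lemma mink_sub_right (X Y Z : Mink) : mink X (Y - Z) = mink X Y - mink X Z := by
  rw [mink_comm, mink_sub_left, mink_comm Y, mink_comm Z]

lemma mink_zero_left (X : Mink) : mink 0 X = 0 := by simp [mink]

lemma sq_fst_of_mem_H3 {X : Mink} (hX : X ∈ H3) : X.1 ^ 2 = 1 + ‖X.2‖ ^ 2 := by
  have := hX.1
  rw [mink, real_inner_self_eq_norm_sq] at this
  linarith

lemma one_le_fst_of_mem_H3 {X : Mink} (hX : X ∈ H3) : 1 ≤ X.1 := by
  nlinarith [sq_fst_of_mem_H3 hX, hX.2, sq_nonneg ‖X.2‖]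

lemma norm_snd_lt_fst {X : Mink} (hX : X ∈ H3) : ‖X.2‖ < X.1 := by
  nlinarith [sq_fst_of_mem_H3 hX, hX.2, norm_nonneg X.2]

/-- The Lorentz form is positive definite on the tangent spaces of `ℍ³`. -/
lemma mink_self_pos {X v : Mink} (hX : X ∈ H3) (hv : mink v X = 0) (hv0 : v ≠ 0) :
    0 < mink v v := by
  have h1 := sq_fst_of_mem_H3 hX
  have h2 := one_le_fst_of_mem_H3 hX
  have h3 : inner ℝ v.2 X.2 = v.1 * X.1 := by rw [mink] at hv; linarith
  have h4 : (v.1 * X.1) ^ 2 ≤ ‖v.2‖ ^ 2 * ‖X.2‖ ^ 2 := by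
    rw [← h3, ← mul_pow, ← sq_abs]
    exact pow_le_pow_left₀ (abs_nonneg _) (abs_real_inner_le_norm _ _) 2
  rw [mink, real_inner_self_eq_norm_sq]
  have h5 : ‖v.2‖ ^ 2 ≤ (‖v.2‖ ^ 2 - v.1 * v.1) * X.1 ^ 2 := by nlinarith
  by_cases hv2 : v.2 = 0
  · exfalso
    rw [hv2, inner_zero_left] at h3
    have : v.1 = 0 := by
      rcases mul_eq_zero.1 h3.symm with h | h
      · exact h
      · linarith
    exact hv0 (Prod.ext this hv2)
  · have h6 : 0 < ‖v.2‖ ^ 2 := by have := norm_pos_iff.2 hv2; positivity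
    by_contra hcon
    nlinarith [sq_nonneg X.1]

lemma mink_self_nonneg {X v : Mink} (hX : X ∈ H3) (hv : mink v X = 0) : 0 ≤ mink v v := by
  by_cases h : v = 0
  · simp [h, mink_zero_left]
  · exact (mink_self_pos hX hv h).le

/-- Two vectors form an orthonormal pair in the tangent space of `ℍ³` at `X`. -/
structure IsTangentPair (X E₁ E₂ : Mink) : Prop where
  mem : X ∈ H3
  tangent₁ : mink E₁ X = 0
  tangent₂ : mink E₂ X = 0
  unit₁ : mink E₁ E₁ = 1
  unit₂ : mink E₂ E₂ = 1
  orth : mink E₁ E₂ = 0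

/-- Expansion of a vector in a Lorentz orthonormal basis. -/
lemma eq_expansion {X E₁ E₂ ν : Mink} (h : IsTangentPair X E₁ E₂) (hX : mink ν X = 0)
    (h1 : mink ν E₁ = 0) (h2 : mink ν E₂ = 0) (hν : mink ν ν = 1) (Z : Mink) :
    Z = -mink Z X • X + mink Z E₁ • E₁ + mink Z E₂ • E₂ + mink Z ν • ν := by
  have hXX := h.mem.1
  have e1 := h.tangent₁
  have e2 := h.tangent₂
  have e11 := h.unit₁
  have e22 := h.unit₂
  have e12 := h.orth
  have e1' : mink X E₁ = 0 := by rw [mink_comm, e1]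
  have e2' : mink X E₂ = 0 := by rw [mink_comm, e2]
  have e21 : mink E₂ E₁ = 0 := by rw [mink_comm, e12]
  have hX' : mink X ν = 0 := by rw [mink_comm, hX]
  have h1' : mink E₁ ν = 0 := by rw [mink_comm, h1]
  have h2' : mink E₂ ν = 0 := by rw [mink_comm, h2]
  have hli : LinearIndependent ℝ ![X, E₁, E₂, ν] := by
    rw [Fintype.linearIndependent_iff]
    intro c hc
    simp only [Fin.sum_univ_four, Matrix.cons_val] at hc
    have k : ∀ Y, mink (c 0 • X + c 1 • E₁ + c 2 • E₂ + c 3 • ν) Y = 0 := fun Y => by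
      rw [hc, mink_zero_left]
    have k0 := k X
    have k1 := k E₁
    have k2 := k E₂
    have k3 := k ν
    clear hc k
    simp only [mink_add_left, mink_smul_left, *] at k0 k1 k2 k3
    intro i
    fin_cases i <;> simp <;> linarith
  have hsp := hli.span_eq_top_of_card_eq_finrank (by simp)
  have hZ : Z ∈ Submodule.span ℝ (Set.range ![X, E₁, E₂, ν]) := by rw [hsp]; trivial
  rw [Submodule.mem_span_range_iff_exists_fun] at hZ
  obtain ⟨c, rfl⟩ := hZ
  simp only [Fin.sum_univ_four, Matrix.cons_val, mink_add_left, mink_smul_left, *]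
  simp

/-! ### The homogeneous extension of a map on the sphere -/

lemma homExt_eq {y : E3} (hy : y ≠ 0) (f : S2 → Mink) : homExt f y = f (radial y) := by
  simp [homExt, radial, hy]

lemma radial_coe (x : S2) : radial (x : E3) = x := by
  ext1
  rw [coe_radial (ne_zero_of_mem_unit_sphere x)]
  simp

lemma homExt_coe (f : S2 → Mink) (x : S2) : homExt f x = f x := by
  rw [homExt_eq (ne_zero_of_mem_unit_sphere x), radial_coe]

lemma homExt_eventuallyEq {y : E3} (hy : y ≠ 0) (f : S2 → Mink) :
    homExt f =ᶠ[nhds y] f ∘ radial := by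
  filter_upwards [isOpen_ne.mem_nhds hy] with z hz
  exact homExt_eq hz f

lemma contMDiffAt_radial {y : E3} (hy : y ≠ 0) : ContMDiffAt 𝓘(ℝ, E3) (𝓡 2) ∞ radial y := by
  -- `ContMDiff.codRestrict_sphere` needs a map that is smooth and of norm one everywhere, so the
  -- origin is removed by passing to an open submanifold.
  let U : TopologicalSpace.Opens E3 := ⟨{z | z ≠ 0}, isOpen_ne⟩
  have hsm : ContMDiff 𝓘(ℝ, E3) 𝓘(ℝ, E3) ∞ fun z : U => ‖(z : E3)‖⁻¹ • (z : E3) := by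
    intro z
    have h1 : ContDiffAt ℝ ∞ (fun z : E3 => ‖z‖⁻¹ • z) z := by
      have hz : (z : E3) ≠ 0 := z.2
      exact ((contDiffAt_norm ℝ hz).inv (norm_ne_zero_iff.2 hz)).smul contDiffAt_id
    have h2 := h1.contMDiffAt
    exact (contMDiffAt_subtype_iff (U := U) (f := fun z : E3 => ‖z‖⁻¹ • z)).2 h2
  have h3 := hsm.codRestrict_sphere (n := 2) (fun z => by
    have hz : (z : E3) ≠ 0 := z.2
    simp [norm_smul, hz])
  have h4 : ContMDiffAt 𝓘(ℝ, E3) (𝓡 2) ∞ (fun z : U => radial z) ⟨y, hy⟩ := by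
    convert! h3 ⟨y, hy⟩ using 1
    ext1 z
    ext1
    exact coe_radial z.2
  exact contMDiffAt_subtype_iff.1 h4

lemma contDiffAt_homExt {f : S2 → Mink} (hf : ContMDiff (𝓡 2) 𝓘(ℝ, Mink) ∞ f) {y : E3}
    (hy : y ≠ 0) : ContDiffAt ℝ ∞ (homExt f) y := by
  rw [← contMDiffAt_iff_contDiffAt]
  exact (hf.contMDiffAt.comp y (contMDiffAt_radial hy)).congr_of_eventuallyEq
    (homExt_eventuallyEq hy f)

lemma inner_frame (x : S2) (i j : Fin 2) :
    inner ℝ (frame x i) (frame x j) = if i = j then 1 else 0 := by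
  have := (OrthonormalBasis.fromOrthogonalSpanSingleton (𝕜 := ℝ) 2
    (ne_zero_of_mem_unit_sphere x)).inner_eq_ite i j
  rw [Submodule.coe_inner] at this
  exact this

lemma inner_coe_frame (x : S2) (i : Fin 2) : inner ℝ (x : E3) (frame x i) = 0 := by
  have := (OrthonormalBasis.fromOrthogonalSpanSingleton (𝕜 := ℝ) 2
    (ne_zero_of_mem_unit_sphere x) i).2
  exact (Submodule.mem_orthogonal_singleton_iff_inner_right).1 this

lemma mfderiv_eq_fderiv_homExt_comp {f : S2 → Mink} (hf : ContMDiff (𝓡 2) 𝓘(ℝ, Mink) ∞ f)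
    (x : S2) : mfderiv (𝓡 2) 𝓘(ℝ, Mink) f x = (fderiv ℝ (homExt f) x).comp
      (mfderiv (𝓡 2) 𝓘(ℝ, E3) ((↑) : S2 → E3) x) := by
  have h1 : f = homExt f ∘ ((↑) : S2 → E3) := by
    ext1 z
    exact (homExt_coe f z).symm
  have h2 : MDifferentiableAt 𝓘(ℝ, E3) 𝓘(ℝ, Mink) (homExt f) (x : E3) :=
    ((contDiffAt_homExt hf (ne_zero_of_mem_unit_sphere x)).differentiableAt
      (by simp)).mdifferentiableAt
  have h3 : MDifferentiableAt (𝓡 2) 𝓘(ℝ, E3) ((↑) : S2 → E3) x :=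
    (contMDiff_coe_sphere (m := 1)).mdifferentiableAt (by simp)
  conv_lhs => rw [h1]
  rw [mfderiv_comp x h2 h3, mfderiv_eq_fderiv]
  rfl

/-- The plane orthogonal to `x` is the range of the differential of the inclusion of `S²`; this
carries the immersion hypothesis, stated with `mfderiv`, over to `fderiv` of `homExt f`. -/
lemma eq_zero_of_fderiv_homExt_eq_zero {f : S2 → Mink} (hf : IsSmoothImmersion f) {x : S2}
    {v : E3} (hv : inner ℝ (x : E3) v = 0) (h : fderiv ℝ (homExt f) x v = 0) : v = 0 := by
  have h1 : v ∈ (ℝ ∙ (x : E3))ᗮ := Submodule.mem_orthogonal_singleton_iff_inner_right.2 hv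
  rw [← range_mvfderiv_subtypeVal (n := 2) x] at h1
  obtain ⟨w, rfl⟩ := h1
  have h2 : mfderiv (𝓡 2) 𝓘(ℝ, Mink) f x w = 0 := by
    rw [mfderiv_eq_fderiv_homExt_comp hf.smooth]
    exact h
  have h3 := hf.immersion x (h2.trans (map_zero _).symm)
  rw [h3]
  exact map_zero _

section

/-! ### The second order condition at a maximum of a function on a surface -/

/-- If `c > 0`, the second derivative test gives a local minimum as well, so `u` is locally constant
and `c = 0`. -/
lemma deriv_conditions_of_isLocalMax {u u' : ℝ → ℝ} {c : ℝ}
    (hu : ∀ᶠ s in nhds 0, HasDerivAt u (u' s) s) (hu' : HasDerivAt u' c 0)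
    (hmax : IsLocalMax u 0) : u' 0 = 0 ∧ c ≤ 0 := by
  have h0 : u' 0 = 0 := hmax.hasDerivAt_eq_zero hu.self_of_nhds
  refine ⟨h0, ?_⟩
  by_contra! hc
  have hd : deriv u =ᶠ[nhds 0] u' := by
    filter_upwards [hu] with s hs using hs.deriv
  have hdd : deriv (deriv u) 0 = c := by rw [hd.deriv_eq, hu'.deriv]
  have hmin : IsLocalMin u 0 := isLocalMin_of_deriv_deriv_pos (by rwa [hdd])
    (by rw [hu.self_of_nhds.deriv, h0]) hu.self_of_nhds.continuousAt
  have hconst : u =ᶠ[nhds 0] fun _ => u 0 := by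
    filter_upwards [hmax, hmin] with s h1 h2 using le_antisymm h1 h2
  have h1 : deriv u =ᶠ[nhds 0] fun _ => 0 := by
    filter_upwards [hconst.eventuallyEq_nhds] with s hs
    rw [hs.deriv_eq, deriv_const]
  rw [h1.deriv_eq, deriv_const] at hdd
  exact hc.ne hdd

/-- The restriction of a homogeneous extension to a line through `x ∈ S²`. -/
lemma hasDerivAt_homExt_line {f : S2 → Mink} (hf : ContMDiff (𝓡 2) 𝓘(ℝ, Mink) ∞ f) (x : S2)
    (v : E3) :
    (∀ᶠ s : ℝ in nhds 0, (x : E3) + s • v ≠ 0 ∧ HasDerivAt (fun s : ℝ => homExt f (x + s • v))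
      (fderiv ℝ (homExt f) (x + s • v) v) s) ∧
    HasDerivAt (fun s : ℝ => fderiv ℝ (homExt f) (x + s • v) v)
      (fderiv ℝ (fderiv ℝ (homExt f)) x v v) 0 := by
  have hl : ∀ s : ℝ, HasDerivAt (fun s : ℝ => (x : E3) + s • v) v s := fun s => by
    simpa using ((hasDerivAt_id s).smul_const v).const_add (x : E3)
  constructor
  · have hne : ∀ᶠ s : ℝ in nhds 0, (x : E3) + s • v ≠ 0 := by
      have hc : ContinuousAt (fun s : ℝ => (x : E3) + s • v) 0 := (hl 0).continuousAt
      refine hc.eventually_ne ?_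
      simpa using ne_zero_of_mem_unit_sphere x
    filter_upwards [hne] with s hs
    refine ⟨hs, ?_⟩
    have h1 := ((contDiffAt_homExt hf hs).differentiableAt (by simp)).hasFDerivAt
    exact h1.comp_hasDerivAt s (hl s)
  · have h2 : DifferentiableAt ℝ (fderiv ℝ (homExt f)) x :=
      ((contDiffAt_homExt hf (ne_zero_of_mem_unit_sphere x)).fderiv_right (m := 1)
        (by norm_cast)).differentiableAt (by simp)
    have h3 : HasFDerivAt (fderiv ℝ (homExt f)) (fderiv ℝ (fderiv ℝ (homExt f)) x)
        ((x : E3) + (0 : ℝ) • v) := by simpa using h2.hasFDerivAt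
    have h4 := h3.comp_hasDerivAt (0 : ℝ) (hl 0)
    simpa using h4.clm_apply (hasDerivAt_const 0 v)

lemma hasDerivAt_mink {X Y : ℝ → Mink} {X' Y' : Mink} {s : ℝ} (hX : HasDerivAt X X' s)
    (hY : HasDerivAt Y Y' s) :
    HasDerivAt (fun s => mink (X s) (Y s)) (mink X' (Y s) + mink (X s) Y') s := by
  unfold mink
  have a1 : HasDerivAt (fun s => (X s).1) X'.1 s :=
    (hasFDerivAt_fst (𝕜 := ℝ) (E := ℝ) (F := E3) (p := X s)).comp_hasDerivAt s hX
  have a2 : HasDerivAt (fun s => (X s).2) X'.2 s :=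
    (hasFDerivAt_snd (𝕜 := ℝ) (E := ℝ) (F := E3) (p := X s)).comp_hasDerivAt s hX
  have b1 : HasDerivAt (fun s => (Y s).1) Y'.1 s :=
    (hasFDerivAt_fst (𝕜 := ℝ) (E := ℝ) (F := E3) (p := Y s)).comp_hasDerivAt s hY
  have b2 : HasDerivAt (fun s => (Y s).2) Y'.2 s :=
    (hasFDerivAt_snd (𝕜 := ℝ) (E := ℝ) (F := E3) (p := Y s)).comp_hasDerivAt s hY
  refine ((a2.inner ℝ b2).fun_sub (a1.fun_mul b1)).congr_deriv ?_
  ring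

variable {f : S2 → Mink} {x : S2}

/-- Obtained by differentiating `⟨f, f⟩ = -1` twice along the line `x + s v`. The second identity is
the normal curvature of the hyperboloid; it produces the zeroth order term `-F` in the flow. -/
lemma mink_fderiv_homExt (hf : IsSmoothImmersion f) (v : E3) :
    mink (fderiv ℝ (homExt f) x v) (f x) = 0 ∧
    mink (fderiv ℝ (fderiv ℝ (homExt f)) x v v) (f x)
      = -mink (fderiv ℝ (homExt f) x v) (fderiv ℝ (homExt f) x v) := by
  obtain ⟨h1, h2⟩ := hasDerivAt_homExt_line hf.smooth x v
  have hone : ∀ᶠ s : ℝ in nhds 0,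
      mink (homExt f (x + s • v)) (homExt f (x + s • v)) = -1 := by
    filter_upwards [h1] with s hs
    rw [homExt_eq hs.1]
    exact (hf.mem _).1
  have hfirst : ∀ᶠ s : ℝ in nhds 0,
      mink (fderiv ℝ (homExt f) (x + s • v) v) (homExt f (x + s • v)) = 0 := by
    filter_upwards [h1, hone.eventually_nhds] with s hs hs'
    have e : (fun s : ℝ => mink (homExt f (x + s • v)) (homExt f (x + s • v)))
        =ᶠ[nhds s] fun _ => -1 := hs'
    have := (hasDerivAt_mink hs.2 hs.2).unique ((hasDerivAt_const s (-1 : ℝ)).congr_of_eventuallyEq e)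
    rw [mink_comm (homExt f _)] at this
    linarith
  have hsecond := (hasDerivAt_mink h2 h1.self_of_nhds.2).unique
    ((hasDerivAt_const (0 : ℝ) (0 : ℝ)).congr_of_eventuallyEq hfirst)
  have h0 := hfirst.self_of_nhds
  simp only [zero_smul, add_zero, homExt_coe] at h0 hsecond
  exact ⟨h0, by linarith⟩

lemma secondDeriv_eq (hf : ContMDiff (𝓡 2) 𝓘(ℝ, Mink) ∞ f) (i j : Fin 2) :
    secondDeriv f x i j = fderiv ℝ (fderiv ℝ (homExt f)) x (frame x i) (frame x j) := by
  have h2 : DifferentiableAt ℝ (fderiv ℝ (homExt f)) x :=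
    ((contDiffAt_homExt hf (ne_zero_of_mem_unit_sphere x)).fderiv_right (m := 1)
      (by norm_cast)).differentiableAt (by simp)
  rw [secondDeriv, fderiv_clm_apply h2 (differentiableAt_const _)]
  simp

/-- The Gram determinant of the coordinate frame is positive. -/
lemma firstForm_pos (hf : IsSmoothImmersion f) :
    0 < firstForm f x 0 0 ∧
    0 < firstForm f x 0 0 * firstForm f x 1 1 - firstForm f x 0 1 ^ 2 := by
  set τ := fderiv ℝ (homExt f) x with hτ
  set e := frame x with he
  have e00 : inner ℝ (e 0) (e 0) = 1 := by rw [he, inner_frame]; rfl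
  have e01 : inner ℝ (e 0) (e 1) = 0 := by rw [he, inner_frame]; rfl
  have e11 : inner ℝ (e 1) (e 1) = 1 := by rw [he, inner_frame]; rfl
  have h0 : 0 < firstForm f x 0 0 := by
    refine mink_self_pos (hf.mem x) (mink_fderiv_homExt hf _).1 fun h => ?_
    have := eq_zero_of_fderiv_homExt_eq_zero hf (inner_coe_frame x 0) h
    rw [← he] at this
    rw [this] at e00
    simp at e00
  refine ⟨h0, ?_⟩
  -- The unnormalised Gram–Schmidt vector: its image has square `g₀₀ det g`.
  set w : E3 := firstForm f x 0 0 • e 1 - firstForm f x 0 1 • e 0 with hw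
  have h1 : 0 < mink (τ w) (τ w) := by
    refine mink_self_pos (hf.mem x) (mink_fderiv_homExt hf _).1 fun h => ?_
    have hperp : inner ℝ (x : E3) w = 0 := by
      rw [hw, inner_sub_right, inner_smul_right, inner_smul_right, inner_coe_frame,
        inner_coe_frame]
      simp
    have := eq_zero_of_fderiv_homExt_eq_zero hf hperp h
    have h2 : inner ℝ w (e 1) = firstForm f x 0 0 := by
      rw [hw, inner_sub_left, inner_smul_left, inner_smul_left, e01, e11]
      simp
    rw [this, inner_zero_left] at h2
    exact h0.ne h2
  have h2 : mink (τ w) (τ w) = firstForm f x 0 0 *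
      (firstForm f x 0 0 * firstForm f x 1 1 - firstForm f x 0 1 ^ 2) := by
    have a0 : mink (τ (e 0)) (τ (e 0)) = firstForm f x 0 0 := rfl
    have a1 : mink (τ (e 0)) (τ (e 1)) = firstForm f x 0 1 := rfl
    have a2 : mink (τ (e 1)) (τ (e 1)) = firstForm f x 1 1 := rfl
    have a3 : mink (τ (e 1)) (τ (e 0)) = firstForm f x 0 1 := mink_comm _ _
    rw [hw, map_sub, map_smul, map_smul]
    simp only [mink_sub_left, mink_sub_right, mink_smul_left, mink_smul_right, a0, a1, a2, a3]
    ring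
  rw [h2] at h1
  exact (pos_iff_pos_of_mul_pos h1).1 h0

lemma meanCurvature_eq (ν : Mink) : meanCurvature f x ν =
    (1 / 2) * (firstForm f x 0 0 * firstForm f x 1 1 - firstForm f x 0 1 ^ 2)⁻¹ *
      (firstForm f x 1 1 * secondForm f x ν 0 0 + firstForm f x 0 0 * secondForm f x ν 1 1
        - firstForm f x 0 1 * (secondForm f x ν 0 1 + secondForm f x ν 1 0)) := by
  have h : firstForm f x 1 0 = firstForm f x 0 1 := mink_comm _ _
  rw [meanCurvature, Matrix.inv_def, Matrix.adjugate_fin_two, Matrix.det_fin_two,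
    Ring.inverse_eq_inv', Matrix.trace_fin_two]
  simp [Matrix.mul_apply, Fin.sum_univ_two, h]
  ring

/-- The tangent plane has an orthonormal basis `τ v₁, τ v₂`, and `2 H` is the trace of the second
fundamental form in this basis. -/
lemma exists_orthonormal_tangent (hf : IsSmoothImmersion f) (ν : Mink) :
    ∃ v₁ v₂ : E3, IsTangentPair (f x) (fderiv ℝ (homExt f) x v₁) (fderiv ℝ (homExt f) x v₂) ∧
      (∃ a b : ℝ, v₁ = a • frame x 0 + b • frame x 1) ∧
      (∃ a b : ℝ, v₂ = a • frame x 0 + b • frame x 1) ∧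
      -mink (fderiv ℝ (fderiv ℝ (homExt f)) x v₁ v₁) ν
        - mink (fderiv ℝ (fderiv ℝ (homExt f)) x v₂ v₂) ν = 2 * meanCurvature f x ν := by
  obtain ⟨hg, hD⟩ := firstForm_pos (x := x) hf
  rw [meanCurvature_eq]
  set τ := fderiv ℝ (homExt f) x with hτ
  set B := fderiv ℝ (fderiv ℝ (homExt f)) x with hB
  have b : ∀ i j, secondForm f x ν i j = -mink (B (frame x i) (frame x j)) ν := fun i j => by
    rw [secondForm, Matrix.of_apply, secondDeriv_eq hf.smooth]
  rw [b, b, b, b]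
  set e := frame x with he
  set g := firstForm f x 0 0
  set k := firstForm f x 0 1
  set l := firstForm f x 1 1
  have a0 : mink (τ (e 0)) (τ (e 0)) = g := rfl
  have a1 : mink (τ (e 0)) (τ (e 1)) = k := rfl
  have a2 : mink (τ (e 1)) (τ (e 1)) = l := rfl
  have a3 : mink (τ (e 1)) (τ (e 0)) = k := mink_comm _ _
  -- Gram–Schmidt for the images of the frame: `α` normalises `τ (e 0)`, and `β` below normalises `τ
  -- (g • e 1 - k • e 0)`.
  set α := (√g)⁻¹ with hα
  have hα2 : α ^ 2 = g⁻¹ := by rw [hα, inv_pow, Real.sq_sqrt hg.le]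
  have hαpos : 0 < α := by positivity
  set β := (√(g * (g * l - k ^ 2)))⁻¹ with hβ
  have hgD : 0 < g * (g * l - k ^ 2) := mul_pos hg hD
  have hβ2 : β ^ 2 = (g * (g * l - k ^ 2))⁻¹ := by rw [hβ, inv_pow, Real.sq_sqrt hgD.le]
  have hβpos : 0 < β := by positivity
  refine ⟨α • e 0, β • (g • e 1 - k • e 0), ⟨hf.mem x, (mink_fderiv_homExt hf _).1,
    (mink_fderiv_homExt hf _).1, ?_, ?_, ?_⟩, ⟨α, 0, by simp⟩, ⟨-(β * k), β * g, ?_⟩, ?_⟩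
  · rw [map_smul, mink_smul_left, mink_smul_right, a0, ← mul_assoc, ← sq, hα2,
      inv_mul_cancel₀ hg.ne']
  · rw [map_smul, mink_smul_left, mink_smul_right, ← mul_assoc, ← sq, hβ2, map_sub, map_smul,
      map_smul]
    simp only [mink_sub_left, mink_sub_right, mink_smul_left, mink_smul_right, a0, a1, a2, a3]
    rw [inv_mul_eq_one₀ hgD.ne']
    ring
  · rw [map_smul, map_smul, mink_smul_left, mink_smul_right, map_sub, map_smul, map_smul]
    simp only [mink_sub_right, mink_smul_right, a0, a1]
    ring
  · rw [smul_sub, smul_smul, smul_smul, neg_smul]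
    abel
  · simp only [map_smul, map_sub, smul_apply, _root_.sub_apply, mink_smul_left,
      mink_sub_left]
    set h00 := mink (B (e 0) (e 0)) ν
    set h01 := mink (B (e 0) (e 1)) ν
    set h10 := mink (B (e 1) (e 0)) ν
    set h11 := mink (B (e 1) (e 1)) ν
    have : -(α * (α * h00)) - β * (g * (β * (g * h11 - k * h01)) - k * (β * (g * h10 - k * h00)))
      = -(α ^ 2 * h00) - β ^ 2 * (g * (g * h11 - k * h01) - k * (g * h10 - k * h00)) := by ring
    rw [this, hα2, hβ2]
    field_simp
    ring

/-- At a maximum of `φ ∘ f`, the derivative of `φ` in the direction `-H ν` is controlled by the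
first and second derivatives of `φ` in Minkowski space. -/
theorem deriv_mean_curvature_le (hf : IsSmoothImmersion f) {ν : Mink} (hν : IsUnitNormal f x ν)
    {φ : Mink → ℝ} {φ' : Mink → Mink →L[ℝ] ℝ} {φ'' : Mink →L[ℝ] Mink →L[ℝ] ℝ}
    (hφ : ∀ X, HasFDerivAt φ (φ' X) X) (hφ' : HasFDerivAt φ' φ'' (f x))
    (hmax : ∀ z, φ (f z) ≤ φ (f x)) :
    ∃ E₁ E₂, IsTangentPair (f x) E₁ E₂ ∧
      φ' (f x) (-(meanCurvature f x ν • ν)) ≤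
        -φ' (f x) (f x) - (1 / 2) * (φ'' E₁ E₁ + φ'' E₂ E₂) := by
  obtain ⟨v₁, v₂, hE, ⟨a₁, b₁, hv₁⟩, ⟨a₂, b₂, hv₂⟩, hH⟩ :=
    exists_orthonormal_tangent (x := x) hf ν
  refine ⟨_, _, hE, ?_⟩
  set τ := fderiv ℝ (homExt f) x with hτ
  set B := fderiv ℝ (fderiv ℝ (homExt f)) x with hB
  -- First and second order conditions for a maximum along the curve `s ↦ f ((x + s v) / |x + s
  -- v|)`.
  have hcond : ∀ v, φ' (f x) (τ v) = 0 ∧ φ'' (τ v) (τ v) + φ' (f x) (B v v) ≤ 0 := by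
    intro v
    obtain ⟨h1, h2⟩ := hasDerivAt_homExt_line hf.smooth x v
    have hu : ∀ᶠ s : ℝ in nhds 0, HasDerivAt (fun s : ℝ => φ (homExt f (x + s • v)))
        (φ' (homExt f (x + s • v)) (fderiv ℝ (homExt f) (x + s • v) v)) s := by
      filter_upwards [h1] with s hs
      exact (hφ _).comp_hasDerivAt s hs.2
    have hφ'0 : HasFDerivAt φ' φ'' (homExt f ((x : E3) + (0 : ℝ) • v)) := by
      simpa [homExt_coe] using hφ'
    have hu'' : HasDerivAt (fun s : ℝ => φ' (homExt f (x + s • v)))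
        (φ'' (τ v)) 0 := by
      have := hφ'0.comp_hasDerivAt (0 : ℝ) h1.self_of_nhds.2
      rwa [zero_smul, add_zero] at this
    have hu' := hu''.clm_apply h2
    have hm : IsLocalMax (fun s : ℝ => φ (homExt f (x + s • v))) 0 := by
      filter_upwards [h1] with s hs
      simpa [homExt_coe, homExt_eq hs.1] using hmax _
    have := deriv_conditions_of_isLocalMax hu hu' hm
    simpa [homExt_coe] using this
  have hτ0 : ∀ v, φ' (f x) (τ v) = 0 := fun v => (hcond v).1
  have hnu : ∀ v, (∃ a b : ℝ, v = a • frame x 0 + b • frame x 1) → mink ν (τ v) = 0 := by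
    rintro v ⟨a, b, rfl⟩
    have i0 : mink ν (τ (frame x 0)) = 0 := hν.2.1 0
    have i1 : mink ν (τ (frame x 1)) = 0 := hν.2.1 1
    rw [map_add, map_smul, map_smul, mink_add_right, mink_smul_right, mink_smul_right, i0, i1]
    simp
  -- The tangential part of `B v v` is annihilated by `φ'`; the part along the position vector and
  -- the part along `ν` remain. Summed over `v₁`, `v₂` this is `ΔX = 2X - 2Hν` tested against `φ'`.
  have hdec : ∀ v, φ' (f x) (B v v) =
      mink (τ v) (τ v) * φ' (f x) (f x) + mink (B v v) ν * φ' (f x) ν := by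
    intro v
    have := eq_expansion hE hν.1 (hnu _ ⟨a₁, b₁, hv₁⟩) (hnu _ ⟨a₂, b₂, hv₂⟩) hν.2.2 (B v v)
    rw [(mink_fderiv_homExt hf v).2] at this
    have h2 := congrArg (φ' (f x)) this
    simp only [map_add, map_smul, smul_eq_mul, neg_neg] at h2
    rw [hτ0, hτ0] at h2
    rw [h2]
    ring
  have c1 := (hcond v₁).2
  have c2 := (hcond v₂).2
  rw [hdec] at c1 c2
  rw [hE.unit₁] at c1
  rw [hE.unit₂] at c2
  rw [map_neg, map_smul, smul_eq_mul]
  have : 2 * meanCurvature f x ν * φ' (f x) ν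
      = -(mink (B v₁ v₁) ν) * φ' (f x) ν - mink (B v₂ v₂) ν * φ' (f x) ν := by
    rw [← hH]; ring
  linarith

end

section

/-! ### The maximum principle -/

/-- Subtracting `η t` makes the derivative at spatial maxima strictly negative, so the maximum over
the compact set `[0, t] × X` cannot be attained at a positive time: just before, the value would be
larger. Then `η → 0`. -/
theorem le_of_deriv_nonpos_at_maxima {X : Type*} [TopologicalSpace X] [CompactSpace X]
    {T : ℝ} {Φ : ℝ → X → ℝ} (hc : ContinuousOn (fun z : ℝ × X => Φ z.1 z.2) (Ico 0 T ×ˢ univ))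
    (hd : ∀ t ∈ Ico 0 T, ∀ x, (∀ z, Φ t z ≤ Φ t x) →
      ∃ D ≤ 0, HasDerivWithinAt (fun s => Φ s x) D (Ico 0 T) t)
    {K : ℝ} (h0 : ∀ x, Φ 0 x ≤ K) {t : ℝ} (ht : t ∈ Ico 0 T) (x : X) : Φ t x ≤ K := by
  have key : ∀ η > 0, Φ t x ≤ K + η * t := by
    intro η hη
    have hsub : Icc 0 t ⊆ Ico 0 T := fun s hs => ⟨hs.1, hs.2.trans_lt ht.2⟩
    have hcont : ContinuousOn (fun z : ℝ × X => Φ z.1 z.2 - η * z.1) (Icc 0 t ×ˢ univ) :=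
      (hc.mono (prod_mono hsub subset_rfl)).sub (by fun_prop)
    obtain ⟨⟨s, z⟩, ⟨hs, -⟩, hmax⟩ := (isCompact_Icc.prod isCompact_univ).exists_isMaxOn
      ⟨(t, x), ⟨⟨ht.1, le_rfl⟩, mem_univ x⟩⟩ hcont
    have hmax' : ∀ r ∈ Icc 0 t, ∀ y, Φ r y - η * r ≤ Φ s z - η * s := fun r hr y =>
      hmax (show (r, y) ∈ Icc 0 t ×ˢ univ from ⟨hr, mem_univ y⟩)
    have hs : s ∈ Icc 0 t := hs
    have htx := hmax' t ⟨ht.1, le_rfl⟩ x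
    rcases hs.1.eq_or_lt with h | h
    · subst h
      linarith [h0 z]
    · exfalso
      obtain ⟨D, hD, hder⟩ := hd s (hsub hs) z fun y => by linarith [hmax' s hs y]
      have h1 : HasDerivWithinAt (fun r => Φ r z - η * r) (D - η * 1) (Icc 0 s) s :=
        (hder.mono ((Icc_subset_Icc_right hs.2).trans hsub)).fun_sub
          ((hasDerivWithinAt_id s _).const_mul η)
      have h2 : IsLocalMaxOn (fun r => Φ r z - η * r) (Icc 0 s) s := by
        filter_upwards [self_mem_nhdsWithin] with r hr
        exact hmax' r ⟨hr.1, hr.2.trans hs.2⟩ z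
      have h3 := h2.hasFDerivWithinAt_nonpos h1.hasFDerivWithinAt (y := 0 - s)
        (sub_mem_posTangentConeAt_of_segment_subset (by
          rw [segment_symm, segment_eq_Icc h.le]))
      simp at h3
      nlinarith
  rcases ht.1.eq_or_lt with h | h
  · rw [← h]; exact h0 x
  · refine le_of_forall_pos_le_add fun η hη => ?_
    have := key (η / t) (by positivity)
    rwa [div_mul_cancel₀ _ h.ne'] at this

variable {F₀ : S2 → Mink} {F : ℝ → S2 → Mink} {T : ℝ}

lemma IsMCF.continuousOn (hF : IsMCF F₀ F T) :
    ContinuousOn (fun z : ℝ × S2 => F z.1 z.2) (Ico 0 T ×ˢ univ) := hF.smooth.continuousOn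

lemma hasFDerivAt_mink_left (p X : Mink) :
    HasFDerivAt (fun X => mink X p)
      ((innerSL ℝ p.2).comp (ContinuousLinearMap.snd ℝ ℝ E3)
        - p.1 • ContinuousLinearMap.fst ℝ ℝ E3) X := by
  have : (fun X => mink X p) = ((innerSL ℝ p.2).comp (ContinuousLinearMap.snd ℝ ℝ E3)
        - p.1 • ContinuousLinearMap.fst ℝ ℝ E3 : Mink →L[ℝ] ℝ) := by
    ext1 X
    simp [mink, real_inner_comm, mul_comm]
  rw [this]
  exact ContinuousLinearMap.hasFDerivAt _

/-- Linear functions grow at most like `e⁻ᵗ` along the flow. -/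
theorem IsMCF.exp_mul_mink_le (hF : IsMCF F₀ F T) (p : Mink) {K : ℝ}
    (h0 : ∀ x, mink (F₀ x) p ≤ K) {t : ℝ} (ht : t ∈ Ico 0 T) (x : S2) :
    Real.exp t * mink (F t x) p ≤ K := by
  refine le_of_deriv_nonpos_at_maxima (Φ := fun t x => Real.exp t * mink (F t x) p) ?_ ?_
    (fun x => by simpa [hF.initial] using h0 x) ht x
  · have h1 : Continuous fun X => mink X p :=
      continuous_iff_continuousAt.2 fun X => (hasFDerivAt_mink_left p X).continuousAt
    exact (by fun_prop : Continuous fun z : ℝ × S2 => Real.exp z.1).continuousOn.mul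
      (h1.comp_continuousOn hF.continuousOn)
  · intro t ht x hmax
    obtain ⟨ν, hν, hder⟩ := hF.evolution t ht x
    have hlin := hasFDerivAt_mink_left p
    -- A linear function has no second derivative, so at a maximum its time derivative is at most
    -- minus itself; the factor `eᵗ` compensates exactly.
    obtain ⟨E₁, E₂, -, hle⟩ := deriv_mean_curvature_le (hF.immersion t ht) hν hlin
      (hasFDerivAt_const _ _) (fun z => le_of_mul_le_mul_left (hmax z) (Real.exp_pos t))
    have hcomp : HasDerivWithinAt (fun s => mink (F s x) p) _ (Ico 0 T) t :=
      (hlin (F t x)).comp_hasDerivWithinAt (f := fun s => F s x) t hder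
    refine ⟨_, ?_, (Real.hasDerivAt_exp t).hasDerivWithinAt.mul hcomp⟩
    have hval : ((innerSL ℝ p.2).comp (ContinuousLinearMap.snd ℝ ℝ E3)
        - p.1 • ContinuousLinearMap.fst ℝ ℝ E3) (F t x) = mink (F t x) p := by
      simp [mink, real_inner_comm, mul_comm]
    rw [hval] at hle
    rw [← mul_add]
    refine mul_nonpos_of_nonneg_of_nonpos (Real.exp_pos t).le ?_
    simp only [zero_apply, add_zero, mul_zero, sub_zero] at hle
    linarith

/-! ### The neck barrier -/

lemma mink_eq (X Y : Mink) :
    mink X Y = X.2 0 * Y.2 0 + X.2 1 * Y.2 1 + X.2 2 * Y.2 2 - X.1 * Y.1 := by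
  simp [mink, PiLp.inner_apply, Fin.sum_univ_three, mul_comm]

/-- The square of `sinh` of the distance to the axis `X₁ = X₂ = 0`. -/
def axisSq (X : Mink) : ℝ := X.2 0 ^ 2 + X.2 1 ^ 2

/-- The function whose sublevel sets are the neck barriers. -/
def neckBarrier (X : Mink) : ℝ := axisSq X - 1 / 4 * Real.log (1 + X.2 2 ^ 2)

/-- The span of `E₁`, `E₂` contains a nonzero vector `V` whose components in the `(X.1, X.2 2)`
plane are parallel to those of `X`, hence timelike or zero. For it `⟨V, V⟩ ≤ axisSq V`, and
Cauchy–Schwarz passes from `V` to the sum over the pair. -/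
lemma IsTangentPair.sum_axisSq_ge {X E₁ E₂ : Mink} (h : IsTangentPair X E₁ E₂) :
    1 ≤ axisSq E₁ + axisSq E₂ := by
  obtain ⟨hX, h1, h2, h11, h22, h12⟩ := h
  have hX0 := hX.2
  have hXX := hX.1
  rw [mink_eq] at hXX
  have hpair : ∀ V : Mink, mink V X = 0 → V.2 2 * X.1 = V.1 * X.2 2 → mink V V ≤ axisSq V := by
    intro V hV hz
    have h3 : (V.2 2 * X.1) ^ 2 ≤ (V.1 * X.1) ^ 2 := by
      rw [hz, mul_pow, mul_pow]
      refine mul_le_mul_of_nonneg_left ?_ (sq_nonneg _)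
      nlinarith [sq_nonneg (X.2 0), sq_nonneg (X.2 1)]
    have h4 : V.2 2 ^ 2 ≤ V.1 ^ 2 := by
      rw [mul_pow, mul_pow] at h3
      exact le_of_mul_le_mul_right h3 (by positivity)
    rw [mink_eq, axisSq]
    nlinarith
  set α := E₁.2 2 * X.1 - E₁.1 * X.2 2 with hα
  set β := E₂.2 2 * X.1 - E₂.1 * X.2 2 with hβ
  by_cases hαβ : α ^ 2 + β ^ 2 = 0
  · have hα0 : α = 0 := by nlinarith [sq_nonneg α, sq_nonneg β]
    have := hpair E₁ h1 (by linarith)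
    have h5 : 0 ≤ axisSq E₂ := by unfold axisSq; positivity
    linarith
  · have hpos : 0 < α ^ 2 + β ^ 2 := lt_of_le_of_ne (by positivity) (Ne.symm hαβ)
    have h6 := hpair (β • E₁ - α • E₂)
      (by rw [mink_sub_left, mink_smul_left, mink_smul_left, h1, h2]; ring)
      (by
        simp only [hα, hβ, Prod.snd_sub, Prod.fst_sub, Prod.smul_snd, Prod.smul_fst,
          PiLp.sub_apply, PiLp.smul_apply, smul_eq_mul]
        ring)
    have h7 : mink (β • E₁ - α • E₂) (β • E₁ - α • E₂) = α ^ 2 + β ^ 2 := by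
      simp only [mink_sub_left, mink_sub_right, mink_smul_left, mink_smul_right, h11, h22, h12,
        mink_comm E₂ E₁]
      ring
    rw [h7] at h6
    have h8 : axisSq (β • E₁ - α • E₂) ≤ (α ^ 2 + β ^ 2) * (axisSq E₁ + axisSq E₂) := by
      simp only [axisSq, Prod.snd_sub, Prod.smul_snd, PiLp.sub_apply, PiLp.smul_apply,
        smul_eq_mul]
      nlinarith [sq_nonneg (α * E₁.2 0 + β * E₂.2 0), sq_nonneg (α * E₁.2 1 + β * E₂.2 1)]
    have h9 : (α ^ 2 + β ^ 2) * 1 ≤ (α ^ 2 + β ^ 2) * (axisSq E₁ + axisSq E₂) := by linarith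
    exact le_of_mul_le_mul_left h9 hpos

/-- Bessel's inequality for `e + u X`, the projection of the third coordinate vector `e` to the
tangent space of `ℍ³`; its square is `1 + u²`. -/
lemma IsTangentPair.sum_sq_le {X E₁ E₂ : Mink} (h : IsTangentPair X E₁ E₂) :
    E₁.2 2 ^ 2 + E₂.2 2 ^ 2 ≤ 1 + X.2 2 ^ 2 := by
  obtain ⟨hX, h1, h2, h11, h22, h12⟩ := h
  set e : Mink := (0, EuclideanSpace.single 2 1) with he
  have hee : mink e e = 1 := by simp [mink_eq, he]
  have hv : ∀ V, mink V e = V.2 2 := fun V => by simp [mink_eq, he]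
  have hv' : ∀ V, mink e V = V.2 2 := fun V => by rw [mink_comm, hv]
  have hXX := hX.1
  have eX : mink e X = X.2 2 := hv' X
  have Xe : mink X e = X.2 2 := hv X
  have eE1 : mink e E₁ = E₁.2 2 := hv' E₁
  have E1e : mink E₁ e = E₁.2 2 := hv E₁
  have eE2 : mink e E₂ = E₂.2 2 := hv' E₂
  have E2e : mink E₂ e = E₂.2 2 := hv E₂
  set a := E₁.2 2
  set b := E₂.2 2
  set u := X.2 2
  have h1' : mink X E₁ = 0 := by rw [mink_comm, h1]
  have h2' : mink X E₂ = 0 := by rw [mink_comm, h2]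
  have h21 : mink E₂ E₁ = 0 := by rw [mink_comm, h12]
  have := mink_self_nonneg (v := e + u • X - a • E₁ - b • E₂) hX (by
    simp only [mink_add_left, mink_sub_left, mink_smul_left, eX, h1, h2, hXX]
    ring)
  simp only [mink_add_left, mink_sub_left, mink_smul_left, mink_add_right, mink_sub_right,
    mink_smul_right, hee, eX, Xe, eE1, E1e, eE2, E2e, h1, h2, hXX, h1', h2',
    h21, h12, h11, h22] at this
  nlinarith

/-- A spatial coordinate of Minkowski space. -/
def spaceCoord (i : Fin 3) : Mink →L[ℝ] ℝ :=
  (EuclideanSpace.proj i : E3 →L[ℝ] ℝ).comp (ContinuousLinearMap.snd ℝ ℝ E3)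

@[simp] lemma spaceCoord_apply (i : Fin 3) (X : Mink) : spaceCoord i X = X.2 i := rfl

/-- The differential of `neckBarrier`. -/
def neckBarrierD (X : Mink) : Mink →L[ℝ] ℝ :=
  (2 * X.2 0) • spaceCoord 0 + (2 * X.2 1) • spaceCoord 1
    - (1 / 2 * (X.2 2 / (1 + X.2 2 ^ 2))) • spaceCoord 2

/-- The second differential of `neckBarrier`. -/
def neckBarrierDD (X : Mink) : Mink →L[ℝ] Mink →L[ℝ] ℝ :=
  ((2 : ℝ) • spaceCoord 0).smulRight (spaceCoord 0)
    + ((2 : ℝ) • spaceCoord 1).smulRight (spaceCoord 1)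
    - ((1 / 2 * ((1 - X.2 2 ^ 2) / (1 + X.2 2 ^ 2) ^ 2)) • spaceCoord 2).smulRight (spaceCoord 2)

lemma hasFDerivAt_neckBarrier (X : Mink) : HasFDerivAt neckBarrier (neckBarrierD X) X := by
  have hc : ∀ i, HasFDerivAt (fun X : Mink => X.2 i) (spaceCoord i) X := fun i =>
    (spaceCoord i).hasFDerivAt
  have hpos : 0 < 1 + X.2 2 ^ 2 := by positivity
  have h1 := (((hc 0).pow 2).add ((hc 1).pow 2)).sub
    (((((hc 2).pow 2).const_add 1).log hpos.ne').const_mul (1 / 4))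
  refine h1.congr_fderiv ?_
  refine ContinuousLinearMap.ext fun V => ?_
  simp [neckBarrierD]
  field_simp
  ring

lemma hasFDerivAt_neckBarrierD (X : Mink) :
    HasFDerivAt neckBarrierD (neckBarrierDD X) X := by
  have hc : ∀ i, HasFDerivAt (fun X : Mink => X.2 i) (spaceCoord i) X := fun i =>
    (spaceCoord i).hasFDerivAt
  have hpos : 0 < 1 + X.2 2 ^ 2 := by positivity
  have hq : HasDerivAt (fun u : ℝ => 1 / 2 * (u / (1 + u ^ 2)))
      (1 / 2 * ((1 - X.2 2 ^ 2) / (1 + X.2 2 ^ 2) ^ 2)) (X.2 2) := by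
    have := ((hasDerivAt_id (X.2 2)).div (((hasDerivAt_id (X.2 2)).pow 2).const_add 1)
      (by simpa using hpos.ne')).const_mul (1 / 2)
    refine this.congr_deriv ?_
    simp
    ring
  exact ((((hc 0).const_mul 2).smul_const (spaceCoord 0)).fun_add
    (((hc 1).const_mul 2).smul_const (spaceCoord 1))).fun_sub
    (((hq.comp_hasFDerivAt (f := fun X : Mink => X.2 2) X (hc 2)) : HasFDerivAt
      (fun X : Mink => 1 / 2 * (X.2 2 / (1 + X.2 2 ^ 2))) _ X).smul_const (spaceCoord 2))

lemma continuous_neckBarrier : Continuous neckBarrier :=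
  continuous_iff_continuousAt.2 fun X => (hasFDerivAt_neckBarrier X).continuousAt

/-- The neck barrier decreases with speed at least `1 / 4` along the flow. -/
theorem IsMCF.neckBarrier_le (hF : IsMCF F₀ F T) {K : ℝ} (h0 : ∀ x, neckBarrier (F₀ x) ≤ K)
    {t : ℝ} (ht : t ∈ Ico 0 T) (x : S2) : neckBarrier (F t x) ≤ K - 1 / 4 * t := by
  suffices neckBarrier (F t x) + 1 / 4 * t ≤ K by linarith
  refine le_of_deriv_nonpos_at_maxima (Φ := fun t x => neckBarrier (F t x) + 1 / 4 * t) ?_ ?_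
    (fun x => by simpa [hF.initial] using h0 x) ht x
  · exact (continuous_neckBarrier.comp_continuousOn hF.continuousOn).add (by fun_prop)
  · intro t ht x hmax
    obtain ⟨ν, hν, hder⟩ := hF.evolution t ht x
    obtain ⟨E₁, E₂, hE, hle⟩ := deriv_mean_curvature_le (hF.immersion t ht) hν
      hasFDerivAt_neckBarrier (hasFDerivAt_neckBarrierD _)
      (fun z => le_of_add_le_add_right (hmax z))
    refine ⟨_, ?_, ((hasFDerivAt_neckBarrier (F t x)).comp_hasDerivWithinAt t hder).add
      ((hasDerivWithinAt_id t _).const_mul (1 / 4))⟩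
    have hS := hE.sum_axisSq_ge
    have hU := hE.sum_sq_le
    set X := F t x
    set u := X.2 2 with hu
    have hpos : 0 < 1 + u ^ 2 := by positivity
    have e1 : neckBarrierD X X = 2 * axisSq X - 1 / 2 * (u ^ 2 / (1 + u ^ 2)) := by
      simp [neckBarrierD, axisSq, ← hu]
      ring
    have e2 : neckBarrierDD X E₁ E₁ + neckBarrierDD X E₂ E₂ = 2 * (axisSq E₁ + axisSq E₂)
        - 1 / 2 * ((1 - u ^ 2) / (1 + u ^ 2) ^ 2) * (E₁.2 2 ^ 2 + E₂.2 2 ^ 2) := by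
      simp [neckBarrierDD, axisSq, ← hu]
      ring
    rw [e1, e2] at hle
    -- The radial term contributes at most `1/2`, the Hessian of `axisSq` at most `-1`, and the
    -- Hessian of the logarithm at most `1/4`: altogether `-1/4`.
    have b1 : u ^ 2 / (1 + u ^ 2) ≤ 1 := by rw [div_le_one hpos]; linarith
    have b2 : (1 - u ^ 2) / (1 + u ^ 2) ^ 2 * (E₁.2 2 ^ 2 + E₂.2 2 ^ 2) ≤ 1 := by
      have c1 : (1 - u ^ 2) / (1 + u ^ 2) ^ 2 ≤ 1 / (1 + u ^ 2) := by
        rw [div_le_div_iff₀ (by positivity) hpos]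
        nlinarith [sq_nonneg u, mul_nonneg (sq_nonneg u) hpos.le]
      calc _ ≤ 1 / (1 + u ^ 2) * (E₁.2 2 ^ 2 + E₂.2 2 ^ 2) := by gcongr
        _ ≤ 1 / (1 + u ^ 2) * (1 + u ^ 2) := by gcongr
        _ = 1 := by field_simp
    have b3 : 0 ≤ axisSq X := by unfold axisSq; positivity
    linarith

end

section

/-! ### A lower bound for the area -/

lemma inner_eq_three (v w : E3) : inner ℝ v w = v 0 * w 0 + v 1 * w 1 + v 2 * w 2 := by
  simp [PiLp.inner_apply, Fin.sum_univ_three, mul_comm]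

/-- The projection of a tangent plane of `ℍ³` to the first two space coordinates. -/
lemma sq_minor_le_gram {X v w : Mink} (hX : X ∈ H3) (hv : mink v X = 0) (hw : mink w X = 0) :
    (v.2 0 * w.2 1 - v.2 1 * w.2 0) ^ 2
      ≤ X.1 ^ 2 * (mink v v * mink w w - mink v w ^ 2) := by
  have hXX := hX.1
  simp only [mink_eq] at *
  set x0 := X.2 0
  set x1 := X.2 1
  set x2 := X.2 2
  set v0 := v.2 0
  set v1 := v.2 1
  set v2 := v.2 2
  set w0 := w.2 0
  set w1 := w.2 1
  set w2 := w.2 2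
  have h1 : v.1 * X.1 = v0 * x0 + v1 * x1 + v2 * x2 := by linarith
  have h2 : w.1 * X.1 = w0 * x0 + w1 * x1 + w2 * x2 := by linarith
  have h3 : X.1 ^ 2 = 1 + (x0 * x0 + x1 * x1 + x2 * x2) := by linarith
  generalize X.1 = t at *
  generalize v.1 = a at *
  generalize w.1 = b at *
  -- Lagrange's identity on the tangent space: with the time components eliminated by tangency, the
  -- right side is `|v × w|² + (x · (v × w))²`, and the minor in question is one component of `v ×
  -- w`.
  have key : t ^ 2 * ((v0 * v0 + v1 * v1 + v2 * v2 - a * a) * (w0 * w0 + w1 * w1 + w2 * w2 - b * b)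
      - (v0 * w0 + v1 * w1 + v2 * w2 - a * b) ^ 2) =
      (v1 * w2 - v2 * w1) ^ 2 + (v2 * w0 - v0 * w2) ^ 2 + (v0 * w1 - v1 * w0) ^ 2
      + (x0 * (v1 * w2 - v2 * w1) + x1 * (v2 * w0 - v0 * w2) + x2 * (v0 * w1 - v1 * w0)) ^ 2 := by
    linear_combination ((v0 * v0 + v1 * v1 + v2 * v2) * (w0 * w0 + w1 * w1 + w2 * w2)
        - (v0 * w0 + v1 * w1 + v2 * w2) ^ 2) * h3
      - (v0 * v0 + v1 * v1 + v2 * v2) * (b * t + (w0 * x0 + w1 * x1 + w2 * x2)) * h2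
      - (w0 * w0 + w1 * w1 + w2 * w2) * (a * t + (v0 * x0 + v1 * x1 + v2 * x2)) * h1
      + 2 * (v0 * w0 + v1 * w1 + v2 * w2) * (b * t * h1 + (v0 * x0 + v1 * x1 + v2 * x2) * h2)
  rw [key]
  nlinarith [sq_nonneg (v1 * w2 - v2 * w1), sq_nonneg (v2 * w0 - v0 * w2),
    sq_nonneg (x0 * (v1 * w2 - v2 * w1) + x1 * (v2 * w0 - v0 * w2) + x2 * (v0 * w1 - v1 * w0))]

/-- The orthonormal frame `x, e₁, e₂` of `ℝ³` at `x ∈ S²`, as a matrix of columns. -/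
def frameMatrix (x : S2) : Matrix (Fin 3) (Fin 3) ℝ :=
  Matrix.of fun i j => ![(x : E3) i, frame x 0 i, frame x 1 i] j

lemma frameMatrix_orthogonal (x : S2) : (frameMatrix x).transpose * frameMatrix x = 1 := by
  have hxx : inner ℝ (x : E3) (x : E3) = (1 : ℝ) := by
    rw [real_inner_self_eq_norm_sq, norm_eq_of_mem_sphere, one_pow]
  have hx0 := inner_coe_frame x 0
  have hx1 := inner_coe_frame x 1
  have h00 : inner ℝ (frame x 0) (frame x 0) = 1 := inner_frame x 0 0
  have h01 : inner ℝ (frame x 0) (frame x 1) = 0 := inner_frame x 0 1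
  have h11 : inner ℝ (frame x 1) (frame x 1) = 1 := inner_frame x 1 1
  rw [inner_eq_three] at hxx hx0 hx1 h00 h01 h11
  ext i j
  fin_cases i <;> fin_cases j <;>
    simp [frameMatrix, Matrix.mul_apply, Fin.sum_univ_three] <;> linarith

lemma det_frameMatrix_sq (x : S2) : (frameMatrix x).det ^ 2 = 1 := by
  have := congrArg Matrix.det (frameMatrix_orthogonal x)
  rwa [Matrix.det_mul, Matrix.det_transpose, Matrix.det_one, ← sq] at this

/-- The cross product of the frame vectors is `± x`. -/
lemma frame_cross_eq (x : S2) :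
    frame x 0 1 * frame x 1 2 - frame x 0 2 * frame x 1 1 = (frameMatrix x).det * (x : E3) 0 ∧
    frame x 0 2 * frame x 1 0 - frame x 0 0 * frame x 1 2 = (frameMatrix x).det * (x : E3) 1 ∧
    frame x 0 0 * frame x 1 1 - frame x 0 1 * frame x 1 0 = (frameMatrix x).det * (x : E3) 2 := by
  have hσ := det_frameMatrix_sq x
  have hxx : inner ℝ (x : E3) (x : E3) = (1 : ℝ) := by
    rw [real_inner_self_eq_norm_sq, norm_eq_of_mem_sphere, one_pow]
  have h00 : inner ℝ (frame x 0) (frame x 0) = 1 := inner_frame x 0 0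
  have h01 : inner ℝ (frame x 0) (frame x 1) = 0 := inner_frame x 0 1
  have h11 : inner ℝ (frame x 1) (frame x 1) = 1 := inner_frame x 1 1
  rw [inner_eq_three] at hxx h00 h01 h11
  have hdet : (frameMatrix x).det = (x : E3) 0 * (frame x 0 1 * frame x 1 2 - frame x 0 2 * frame x 1 1)
      + (x : E3) 1 * (frame x 0 2 * frame x 1 0 - frame x 0 0 * frame x 1 2)
      + (x : E3) 2 * (frame x 0 0 * frame x 1 1 - frame x 0 1 * frame x 1 0) := by
    simp [frameMatrix, Matrix.det_fin_three]
    ring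
  generalize (frameMatrix x).det = σ at *
  generalize (x : E3) 0 = x0 at *
  generalize (x : E3) 1 = x1 at *
  generalize (x : E3) 2 = x2 at *
  generalize frame x 0 0 = u0 at *
  generalize frame x 0 1 = u1 at *
  generalize frame x 0 2 = u2 at *
  generalize frame x 1 0 = w0 at *
  generalize frame x 1 1 = w1 at *
  generalize frame x 1 2 = w2 at *
  have hN : (u1 * w2 - u2 * w1) ^ 2 + (u2 * w0 - u0 * w2) ^ 2 + (u0 * w1 - u1 * w0) ^ 2 = 1 := by
    linear_combination (w0 * w0 + w1 * w1 + w2 * w2) * h00 + h11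
      - (u0 * w0 + u1 * w1 + u2 * w2) * h01
  -- Here `|u × w| = |x| = 1` and `x · (u × w) = σ` with `σ² = 1`, so `|u × w - σ x|² = 1 - 2σ² + σ²
  -- = 0`.
  have hsum : (u1 * w2 - u2 * w1 - σ * x0) ^ 2 + (u2 * w0 - u0 * w2 - σ * x1) ^ 2
      + (u0 * w1 - u1 * w0 - σ * x2) ^ 2 = 0 := by
    linear_combination hN + σ ^ 2 * hxx + 2 * σ * hdet - hσ
  have z0 : u1 * w2 - u2 * w1 - σ * x0 = 0 := by
    nlinarith [sq_nonneg (u1 * w2 - u2 * w1 - σ * x0), sq_nonneg (u2 * w0 - u0 * w2 - σ * x1),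
      sq_nonneg (u0 * w1 - u1 * w0 - σ * x2)]
  have z1 : u2 * w0 - u0 * w2 - σ * x1 = 0 := by
    nlinarith [sq_nonneg (u1 * w2 - u2 * w1 - σ * x0), sq_nonneg (u2 * w0 - u0 * w2 - σ * x1),
      sq_nonneg (u0 * w1 - u1 * w0 - σ * x2)]
  have z2 : u0 * w1 - u1 * w0 - σ * x2 = 0 := by
    nlinarith [sq_nonneg (u1 * w2 - u2 * w1 - σ * x0), sq_nonneg (u2 * w0 - u0 * w2 - σ * x1),
      sq_nonneg (u0 * w1 - u1 * w0 - σ * x2)]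
  exact ⟨sub_eq_zero.1 z0, sub_eq_zero.1 z1, sub_eq_zero.1 z2⟩

variable {f : S2 → Mink} {x : S2}

/-- The pulled back metric in the standard basis of `ℝ³`. -/
def ambientForm (f : S2 → Mink) (x : S2) (i j : Fin 3) : ℝ :=
  mink (fderiv ℝ (homExt f) x (EuclideanSpace.single i 1))
    (fderiv ℝ (homExt f) x (EuclideanSpace.single j 1))

lemma eq_sum_single (v : E3) : v = v 0 • EuclideanSpace.single 0 (1 : ℝ)
    + v 1 • EuclideanSpace.single 1 (1 : ℝ) + v 2 • EuclideanSpace.single 2 (1 : ℝ) := by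
  ext i
  fin_cases i <;> simp

lemma mink_fderiv_eq_ambientForm (v w : E3) :
    mink (fderiv ℝ (homExt f) x v) (fderiv ℝ (homExt f) x w) =
      ∑ i, ∑ j, v i * w j * ambientForm f x i j := by
  conv_lhs => rw [eq_sum_single v, eq_sum_single w]
  simp only [map_add, map_smul, mink_add_left, mink_add_right, mink_smul_left, mink_smul_right,
    Fin.sum_univ_three, ambientForm]
  ring

/-- The Gram determinant does not depend on the frame. -/
lemma det_firstForm_eq (f : S2 → Mink) (x : S2) : (firstForm f x).det =
    (x : E3) 0 ^ 2 * (ambientForm f x 1 1 * ambientForm f x 2 2 - ambientForm f x 1 2 ^ 2)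
    + (x : E3) 1 ^ 2 * (ambientForm f x 0 0 * ambientForm f x 2 2 - ambientForm f x 0 2 ^ 2)
    + (x : E3) 2 ^ 2 * (ambientForm f x 0 0 * ambientForm f x 1 1 - ambientForm f x 0 1 ^ 2)
    + 2 * (x : E3) 0 * (x : E3) 1 *
      (ambientForm f x 0 2 * ambientForm f x 1 2 - ambientForm f x 0 1 * ambientForm f x 2 2)
    + 2 * (x : E3) 0 * (x : E3) 2 *
      (ambientForm f x 0 1 * ambientForm f x 1 2 - ambientForm f x 0 2 * ambientForm f x 1 1)
    + 2 * (x : E3) 1 * (x : E3) 2 *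
      (ambientForm f x 0 1 * ambientForm f x 0 2 - ambientForm f x 1 2 * ambientForm f x 0 0) := by
  have hσ := det_frameMatrix_sq x
  obtain ⟨c0, c1, c2⟩ := frame_cross_eq x
  have hg : ∀ i j, firstForm f x i j =
      ∑ k, ∑ l, frame x i k * frame x j l * ambientForm f x k l := fun i j =>
    mink_fderiv_eq_ambientForm _ _
  have q10 : ambientForm f x 1 0 = ambientForm f x 0 1 := mink_comm _ _
  have q20 : ambientForm f x 2 0 = ambientForm f x 0 2 := mink_comm _ _
  have q21 : ambientForm f x 2 1 = ambientForm f x 1 2 := mink_comm _ _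
  rw [Matrix.det_fin_two, hg, hg, hg, hg]
  simp only [Fin.sum_univ_three, q10, q20, q21]
  generalize (frameMatrix x).det = σ at *
  generalize (x : E3) 0 = x0 at *
  generalize (x : E3) 1 = x1 at *
  generalize (x : E3) 2 = x2 at *
  generalize frame x 0 0 = u0 at *
  generalize frame x 0 1 = u1 at *
  generalize frame x 0 2 = u2 at *
  generalize frame x 1 0 = w0 at *
  generalize frame x 1 1 = w1 at *
  generalize frame x 1 2 = w2 at *
  generalize ambientForm f x 0 0 = q00 at *
  generalize ambientForm f x 0 1 = q01 at *
  generalize ambientForm f x 0 2 = q02 at *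
  generalize ambientForm f x 1 1 = q11 at *
  generalize ambientForm f x 1 2 = q12 at *
  generalize ambientForm f x 2 2 = q22 at *
  have e : ∀ a b : ℝ, a * b = (σ * a) * (σ * b) := fun a b => by linear_combination (-a * b) * hσ
  have s0 : x0 ^ 2 = (u1 * w2 - u2 * w1) ^ 2 := by rw [sq, e, ← c0]; ring
  have s1 : x1 ^ 2 = (u2 * w0 - u0 * w2) ^ 2 := by rw [sq, e, ← c1]; ring
  have s2 : x2 ^ 2 = (u0 * w1 - u1 * w0) ^ 2 := by rw [sq, e, ← c2]; ring
  have s01 : 2 * x0 * x1 = 2 * ((u1 * w2 - u2 * w1) * (u2 * w0 - u0 * w2)) := by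
    rw [mul_assoc, e x0, ← c0, ← c1]
  have s02 : 2 * x0 * x2 = 2 * ((u1 * w2 - u2 * w1) * (u0 * w1 - u1 * w0)) := by
    rw [mul_assoc, e x0, ← c0, ← c2]
  have s12 : 2 * x1 * x2 = 2 * ((u2 * w0 - u0 * w2) * (u0 * w1 - u1 * w0)) := by
    rw [mul_assoc, e x1, ← c1, ← c2]
  rw [s0, s1, s2, s01, s02, s12]
  ring

/-- `frame` is an arbitrary choice at each point and need not be continuous; the frame-free formula
`det_firstForm_eq` avoids it. -/
lemma continuous_areaDensity (hf : ContMDiff (𝓡 2) 𝓘(ℝ, Mink) ∞ f) :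
    Continuous (areaDensity f) := by
  have hτ : Continuous fun x : S2 => fderiv ℝ (homExt f) x := by
    rw [continuous_iff_continuousAt]
    intro x
    have h1 : ContinuousAt (fderiv ℝ (homExt f)) x :=
      ((contDiffAt_homExt hf (ne_zero_of_mem_unit_sphere x)).fderiv_right (m := 0)
        (by norm_cast)).continuousAt
    exact h1.comp (f := ((↑) : S2 → E3)) continuous_subtype_val.continuousAt
  have hq : ∀ i j, Continuous fun x => ambientForm f x i j := by
    intro i j
    have h1 := fun k : Fin 3 => hτ.clm_apply (continuous_const (y := EuclideanSpace.single k (1 : ℝ)))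
    have h2 : ∀ k l, Continuous fun x : S2 =>
        (fderiv ℝ (homExt f) x (EuclideanSpace.single k 1)).2 l := fun k l =>
      (spaceCoord l).continuous.comp (h1 k)
    have h3 : ∀ k, Continuous fun x : S2 =>
        (fderiv ℝ (homExt f) x (EuclideanSpace.single k 1)).1 := fun k =>
      continuous_fst.comp (h1 k)
    simp only [ambientForm, mink_eq]
    have := h2 i
    have := h2 j
    have := h3 i
    have := h3 j
    fun_prop
  have hx : ∀ i, Continuous fun x : S2 => (x : E3) i := fun i => by fun_prop
  unfold areaDensity
  refine Real.continuous_sqrt.comp ?_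
  simp only [det_firstForm_eq]
  fun_prop

/-- The round measure in terms of Lebesgue measure on the unit ball. -/
lemma toSphere_eq_smul_map : (volume : Measure E3).toSphere =
    (3 : ENNReal) • ((volume : Measure E3).restrict (ball 0 1 \ {0})).map radial := by
  have hmeas : Measurable radial :=
    measurable_of_continuousOn_compl_singleton 0 fun y hy =>
      (continuousAt_radial hy).continuousWithinAt
  ext s hs
  rw [Measure.toSphere_apply' _ hs, Measure.smul_apply, Measure.map_apply hmeas hs,
    Measure.restrict_apply (hmeas hs)]
  simp only [finrank_euclideanSpace, Fintype.card_fin, Nat.cast_ofNat, smul_eq_mul]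
  congr 2
  ext y
  simp only [mem_inter_iff, mem_preimage, mem_sdiff, mem_ball, dist_zero_right, mem_singleton_iff]
  constructor
  · rintro ⟨r, hr, _, ⟨x, hx, rfl⟩, rfl⟩
    have hn : ‖r • (x : E3)‖ = r := by
      rw [norm_smul, norm_eq_of_mem_sphere, mul_one, Real.norm_of_nonneg hr.1.le]
    have h0 : r • (x : E3) ≠ 0 := norm_ne_zero_iff.1 (by rw [hn]; exact hr.1.ne')
    have hrad : radial (r • (x : E3)) = x := by
      ext1
      rw [coe_radial h0, hn, smul_smul, inv_mul_cancel₀ hr.1.ne', one_smul]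
    exact ⟨by rw [hrad]; exact hx, by rw [hn]; exact hr.2, h0⟩
  · rintro ⟨h1, h2, h3⟩
    refine ⟨‖y‖, ⟨norm_pos_iff.2 h3, h2⟩, radial y, ⟨_, h1, rfl⟩, ?_⟩
    simp [coe_radial h3, smul_smul, h3]

lemma homExt_smul {r : ℝ} (hr : 0 < r) {y : E3} (hy : y ≠ 0) (f : S2 → Mink) :
    homExt f (r • y) = homExt f y := by
  rw [homExt_eq hy, homExt_eq (smul_ne_zero hr.ne' hy)]
  congr 1
  ext1
  rw [coe_radial hy, coe_radial (smul_ne_zero hr.ne' hy), norm_smul, Real.norm_of_nonneg hr.le,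
    smul_smul, mul_inv, mul_comm, ← mul_assoc, mul_inv_cancel₀ hr.ne', one_mul]

lemma fderiv_homExt_smul (hf : ContMDiff (𝓡 2) 𝓘(ℝ, Mink) ∞ f) {r : ℝ} (hr : 0 < r) (x : S2)
    (v : E3) : fderiv ℝ (homExt f) (r • (x : E3)) v = r⁻¹ • fderiv ℝ (homExt f) x v := by
  have hx := ne_zero_of_mem_unit_sphere x
  have h1 : HasFDerivAt (homExt f) (fderiv ℝ (homExt f) (r • (x : E3))) (r • (x : E3)) :=
    ((contDiffAt_homExt hf (smul_ne_zero hr.ne' hx)).differentiableAt (by simp)).hasFDerivAt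
  have h2 : HasFDerivAt (fun y : E3 => r • y) (r • ContinuousLinearMap.id ℝ E3) (x : E3) :=
    (hasFDerivAt_id _).const_smul r
  have h3 := h1.comp (x : E3) h2
  have h4 : homExt f ∘ (fun y : E3 => r • y) =ᶠ[nhds (x : E3)] homExt f := by
    filter_upwards [isOpen_ne.mem_nhds hx] with z hz
    exact homExt_smul hr hz f
  have h5 := (h3.congr_of_eventuallyEq h4.symm).fderiv
  rw [h5]
  simp [smul_smul, hr.ne']

lemma fderiv_homExt_self (hf : ContMDiff (𝓡 2) 𝓘(ℝ, Mink) ∞ f) (x : S2) :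
    fderiv ℝ (homExt f) x (x : E3) = 0 := by
  have hx := ne_zero_of_mem_unit_sphere x
  have h1 := (hasDerivAt_homExt_line hf x x).1.self_of_nhds.2
  have h2 : (fun s : ℝ => homExt f ((x : E3) + s • (x : E3))) =ᶠ[nhds 0] fun _ => homExt f x := by
    filter_upwards [Ioi_mem_nhds (show (-1 : ℝ) < 0 by norm_num)] with s hs
    have : (x : E3) + s • (x : E3) = (1 + s) • (x : E3) := by rw [add_smul, one_smul]
    rw [this, homExt_smul (by simp at hs; linarith) hx]
  have := h1.unique ((hasDerivAt_const (0 : ℝ) _).congr_of_eventuallyEq h2)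
  simpa using this

/-- The first two space coordinates of `f`, together with the radius. -/
def shadow (f : S2 → Mink) (y : E3) : E3 :=
  (homExt f y).2 0 • EuclideanSpace.single 0 1 + (homExt f y).2 1 • EuclideanSpace.single 1 1
    + ‖y‖ • EuclideanSpace.single 2 1

/-- The differential of `shadow f` at `y = r x`, `x ∈ S²`. -/
def shadowD (f : S2 → Mink) (y : E3) : E3 →L[ℝ] E3 :=
  ((spaceCoord 0).comp (fderiv ℝ (homExt f) y)).smulRight (EuclideanSpace.single 0 1)
    + ((spaceCoord 1).comp (fderiv ℝ (homExt f) y)).smulRight (EuclideanSpace.single 1 1)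
    + (innerSL ℝ (radial y : E3)).smulRight (EuclideanSpace.single 2 1)

lemma hasFDerivAt_shadow (hf : ContMDiff (𝓡 2) 𝓘(ℝ, Mink) ∞ f) {y : E3} (hy : y ≠ 0) :
    HasFDerivAt (shadow f) (shadowD f y) y := by
  have h1 : HasFDerivAt (homExt f) (fderiv ℝ (homExt f) y) y :=
    ((contDiffAt_homExt hf hy).differentiableAt (by simp)).hasFDerivAt
  have hc : ∀ i, HasFDerivAt (fun y => (homExt f y).2 i)
      ((spaceCoord i).comp (fderiv ℝ (homExt f) y)) y := fun i =>
    (spaceCoord i).hasFDerivAt.comp y h1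
  have hn : HasFDerivAt (fun y : E3 => ‖y‖) (innerSL ℝ (radial y : E3)) y := by
    have := (hasStrictFDerivAt_norm_sq y).hasFDerivAt.sqrt (by simpa using hy)
    simp only [Real.sqrt_sq (norm_nonneg _)] at this
    refine this.congr_fderiv ?_
    ext v
    simp [coe_radial hy]
    field_simp
  exact (((hc 0).smul_const _).fun_add ((hc 1).smul_const _)).fun_add (hn.smul_const _)

/-- Adding the radius as a third coordinate turns the planar projection of a surface into a map
between domains of `ℝ³`. In the frame `x, e₁, e₂` its differential splits into the radial direction
and `r⁻¹` times the projected tangent map, so the determinant is `± r⁻² J`. The minor `J` is bounded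
by `sq_minor_le_gram`, and `r ≥ 1/2` gives the factor `4`. -/
lemma abs_det_shadowD_le (hf : IsSmoothImmersion f) {r : ℝ} (hr : 1 / 2 ≤ r) (x : S2) {C : ℝ}
    (hC : (f x).1 ≤ C) : |(shadowD f (r • (x : E3))).det| ≤ 4 * C * areaDensity f x := by
  have hrp : 0 < r := by linarith
  have hx := ne_zero_of_mem_unit_sphere x
  have hrad : (radial (r • (x : E3)) : E3) = x := by
    rw [coe_radial (smul_ne_zero hrp.ne' hx), norm_smul, norm_eq_of_mem_sphere, mul_one,
      Real.norm_of_nonneg hrp.le, smul_smul, inv_mul_cancel₀ hrp.ne', one_smul]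
  set τ := fderiv ℝ (homExt f) x with hτ
  set J := (τ (frame x 0)).2 0 * (τ (frame x 1)).2 1 - (τ (frame x 0)).2 1 * (τ (frame x 1)).2 0
    with hJ
  have hD : ∀ v, shadowD f (r • (x : E3)) v = (r⁻¹ * (τ v).2 0) • EuclideanSpace.single 0 1
      + (r⁻¹ * (τ v).2 1) • EuclideanSpace.single 1 1
      + inner ℝ (x : E3) v • EuclideanSpace.single 2 1 := by
    intro v
    simp [shadowD, fderiv_homExt_smul hf.smooth hrp, hrad, hτ]
  have hprod : stdMatrix (shadowD f (r • (x : E3))) * frameMatrix x =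
      Matrix.of fun i j => shadowD f (r • (x : E3)) (![(x : E3), frame x 0, frame x 1] j) i := by
    ext i j
    have : ∀ v : E3, ∑ k, stdMatrix (shadowD f (r • (x : E3))) i k * v k
        = shadowD f (r • (x : E3)) v i := by
      intro v
      conv_rhs => rw [eq_sum_single v]
      simp [stdMatrix, Fin.sum_univ_three, mul_comm]
    rw [Matrix.of_apply, ← this, Matrix.mul_apply]
    refine Finset.sum_congr rfl fun k _ => ?_
    congr 1
    fin_cases j <;> rfl
  have hdet : (shadowD f (r • (x : E3))).det * (frameMatrix x).det = r⁻¹ ^ 2 * J := by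
    rw [det_eq_det_stdMatrix, ← Matrix.det_mul, hprod, Matrix.det_fin_three]
    have hxx : inner ℝ (x : E3) (x : E3) = (1 : ℝ) := by
      rw [real_inner_self_eq_norm_sq, norm_eq_of_mem_sphere, one_pow]
    have hxt : τ (x : E3) = 0 := fderiv_homExt_self hf.smooth x
    simp only [Matrix.of_apply, Matrix.cons_val, hD, hxt, hxx, inner_coe_frame]
    simp [hJ]
    ring
  have habs : |(shadowD f (r • (x : E3))).det| = r⁻¹ ^ 2 * |J| := by
    have h1 : |(frameMatrix x).det| = 1 := by
      rw [← sq_eq_sq₀ (abs_nonneg _) zero_le_one, sq_abs, det_frameMatrix_sq, one_pow]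
    have := congrArg abs hdet
    rwa [abs_mul, h1, mul_one, abs_mul, abs_of_nonneg (by positivity : 0 ≤ r⁻¹ ^ 2)] at this
  have hr2 : r⁻¹ ^ 2 ≤ 4 := by
    have : r⁻¹ ≤ 2 := by rw [inv_le_comm₀ hrp two_pos]; linarith
    have h0 : 0 ≤ r⁻¹ := by positivity
    nlinarith
  have hX1 := one_le_fst_of_mem_H3 (hf.mem x)
  have hJle : |J| ≤ C * areaDensity f x := by
    have h1 := sq_minor_le_gram (hf.mem x) (mink_fderiv_homExt hf (frame x 0)).1
      (mink_fderiv_homExt hf (frame x 1)).1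
    have h2 : (firstForm f x).det = mink (τ (frame x 0)) (τ (frame x 0)) *
        mink (τ (frame x 1)) (τ (frame x 1)) - mink (τ (frame x 0)) (τ (frame x 1)) ^ 2 := by
      rw [Matrix.det_fin_two, sq]
      congr 2
      exact mink_comm _ _
    rw [← h2] at h1
    calc |J| = √(J ^ 2) := (Real.sqrt_sq_eq_abs _).symm
      _ ≤ √((f x).1 ^ 2 * (firstForm f x).det) := Real.sqrt_le_sqrt h1
      _ = (f x).1 * areaDensity f x := by
        rw [Real.sqrt_mul (sq_nonneg _), Real.sqrt_sq (by linarith), areaDensity]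
      _ ≤ C * areaDensity f x := by
        gcongr
        exact Real.sqrt_nonneg _
  calc _ = r⁻¹ ^ 2 * |J| := habs
    _ ≤ 4 * (C * areaDensity f x) := by gcongr
    _ = _ := by ring

/-- If the projection of a surface to the first two space coordinates contains a disc, then its
area is bounded from below. -/
theorem area_ge_of_projection (hf : IsSmoothImmersion f) {C δ : ℝ} {a : E3}
    (hC : ∀ x, (f x).1 ≤ C) (hδ4 : δ ≤ 1 / 4) (ha : a 2 = 3 / 4)
    (hdisc : ∀ z : E3, ‖z - a‖ < δ → ∃ x, (f x).2 0 = z 0 ∧ (f x).2 1 = z 1) :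
    volume.real (ball a δ) / (4 * C) ≤ area f := by
  have hC0 : 0 < C := by
    have x : S2 := radial 0
    linarith [one_le_fst_of_mem_H3 (hf.mem x), hC x]
  have hAc := continuous_areaDensity hf.smooth
  have hA0 : ∀ x, 0 ≤ areaDensity f x := fun x => Real.sqrt_nonneg _
  have hmeas : Measurable radial :=
    measurable_of_continuousOn_compl_singleton 0 fun y hy =>
      (continuousAt_radial hy).continuousWithinAt
  set S : Set E3 := {y | 1 / 2 < ‖y‖ ∧ ‖y‖ < 1} with hS
  have hSm : MeasurableSet S :=
    ((isOpen_lt continuous_const continuous_norm).inter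
      (isOpen_lt continuous_norm continuous_const)).measurableSet
  have hS0 : ∀ y ∈ S, y ≠ 0 := by
    rintro y hy rfl
    have := hy.1
    simp at this
    linarith
  have hrep : ∀ y ∈ S, y = ‖y‖ • (radial y : E3) := fun y hy => by
    rw [coe_radial (hS0 y hy), smul_smul, mul_inv_cancel₀ (norm_ne_zero_iff.2 (hS0 y hy)),
      one_smul]
  -- The third coordinate of a point of the ball lies in `(1/2, 1)`, because `a 2 = 3/4` and `δ ≤
  -- 1/4`, and serves as the radius of a preimage. The area formula below only needs covering, not
  -- injectivity.
  have himg : ball a δ ⊆ shadow f '' S := by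
    intro z hz
    have hz' : ‖z - a‖ < δ := by simpa [dist_eq_norm] using hz
    obtain ⟨x, h0, h1⟩ := hdisc z hz'
    have h2 : |z 2 - 3 / 4| < 1 / 4 := by
      rw [← ha]
      exact ((PiLp.norm_apply_le (z - a) 2).trans_lt hz').trans_le hδ4
    rw [abs_lt] at h2
    have hz2 : 0 < z 2 := by linarith
    have hn : ‖z 2 • (x : E3)‖ = z 2 := by
      rw [norm_smul, norm_eq_of_mem_sphere, mul_one, Real.norm_of_nonneg hz2.le]
    refine ⟨z 2 • (x : E3), ⟨by rw [hn]; linarith, by rw [hn]; linarith⟩, ?_⟩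
    rw [shadow, hn, homExt_smul hz2 (ne_zero_of_mem_unit_sphere x), homExt_coe, h0, h1]
    exact (eq_sum_single z).symm
  have h1 : volume (ball a δ) ≤ ∫⁻ y in S, ENNReal.ofReal |(shadowD f y).det| :=
    (measure_mono himg).trans (addHaar_image_le_lintegral_abs_det_fderiv volume hSm fun y hy =>
      (hasFDerivAt_shadow hf.smooth (hS0 y hy)).hasFDerivWithinAt)
  have h2 : ∫⁻ y in S, ENNReal.ofReal |(shadowD f y).det| ≤
      ∫⁻ y in S, ENNReal.ofReal (4 * C * areaDensity f (radial y)) := by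
    refine setLIntegral_mono' hSm fun y hy => ENNReal.ofReal_le_ofReal ?_
    have := abs_det_shadowD_le hf hy.1.le (radial y) (hC _)
    rwa [← hrep y hy] at this
  have h3 : ∫⁻ y in S, ENNReal.ofReal (4 * C * areaDensity f (radial y)) ≤
      ∫⁻ y in ball 0 1 \ {0}, ENNReal.ofReal (4 * C * areaDensity f (radial y)) :=
    lintegral_mono_set fun y hy => ⟨by simpa using hy.2, hS0 y hy⟩
  have h4 : ∫⁻ y in ball 0 1 \ {0}, ENNReal.ofReal (4 * C * areaDensity f (radial y)) ≤
      ∫⁻ x, ENNReal.ofReal (4 * C * areaDensity f x) ∂(volume : Measure E3).toSphere := by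
    rw [toSphere_eq_smul_map, lintegral_smul_measure, lintegral_map (by fun_prop) hmeas]
    exact le_mul_of_one_le_left zero_le (by norm_num)
  have hint : Integrable (fun x => 4 * C * areaDensity f x) (volume : Measure E3).toSphere :=
    (continuous_const.mul hAc).integrable_of_hasCompactSupport (HasCompactSupport.of_compactSpace _)
  rw [← ofReal_integral_eq_lintegral_ofReal hint
    (Filter.Eventually.of_forall fun x => mul_nonneg (by positivity) (hA0 x)),
    integral_const_mul] at h4
  have h5 := ((h1.trans h2).trans h3).trans h4
  have h6 : 0 ≤ area f := integral_nonneg hA0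
  rw [div_le_iff₀ (by positivity), measureReal_def, mul_comm]
  exact ENNReal.toReal_le_of_le_ofReal (by positivity) h5

end

/-! ### Points and distances of hyperbolic space -/

/-- The point of `ℍ³` with given space coordinates. -/
def hlift (v : E3) : Mink := (√(1 + ‖v‖ ^ 2), v)

@[simp] lemma hlift_snd (v : E3) : (hlift v).2 = v := rfl

lemma hlift_mem (v : E3) : hlift v ∈ H3 := by
  have h : 0 < 1 + ‖v‖ ^ 2 := by positivity
  refine ⟨?_, Real.sqrt_pos.2 h⟩
  rw [mink, hlift, real_inner_self_eq_norm_sq, Real.mul_self_sqrt h.le]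
  ring

lemma hlift_of_mem {X : Mink} (hX : X ∈ H3) : hlift X.2 = X := by
  ext1
  · rw [hlift, ← sq_fst_of_mem_H3 hX, Real.sqrt_sq hX.2.le]
  · rfl

lemma contDiff_hlift : ContDiff ℝ ∞ hlift := by
  have h : ∀ v : E3, 1 + ‖v‖ ^ 2 ≠ 0 := fun v => by positivity
  exact ((contDiff_const.add (contDiff_norm_sq ℝ)).sqrt h).prodMk contDiff_id

lemma continuous_hlift : Continuous hlift := contDiff_hlift.continuous

lemma neg_mink_ge (X Y : Mink) : (X.1 - ‖X.2‖) * Y.1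
    + ‖X.2‖ * (Y.1 - ‖Y.2‖) ≤ -mink X Y := by
  have := abs_le.1 (abs_real_inner_le_norm X.2 Y.2)
  rw [mink]
  nlinarith

lemma one_le_neg_mink {X Y : Mink} (hX : X ∈ H3) (hY : Y ∈ H3) : 1 ≤ -mink X Y := by
  have h1 := (abs_le.1 (abs_real_inner_le_norm X.2 Y.2)).2
  have h2 := sq_fst_of_mem_H3 hX
  have h3 := sq_fst_of_mem_H3 hY
  have h4 := hX.2
  have h5 := hY.2
  have h6 : 1 + ‖X.2‖ * ‖Y.2‖ ≤ X.1 * Y.1 := by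
    refine le_of_sq_le_sq ?_ (by positivity)
    rw [mul_pow, h2, h3]
    nlinarith [sq_nonneg (‖X.2‖ - ‖Y.2‖)]
  rw [mink]
  linarith

lemma neg_mink_le {X Y : Mink} (hX : X ∈ H3) (hY : Y ∈ H3) : -mink X Y ≤ 2 * X.1 * Y.1 := by
  have h1 := (abs_le.1 (abs_real_inner_le_norm X.2 Y.2)).1
  have h2 := norm_snd_lt_fst hX
  have h3 := norm_snd_lt_fst hY
  have h4 : ‖X.2‖ * ‖Y.2‖ ≤ X.1 * Y.1 :=
    mul_le_mul h2.le h3.le (norm_nonneg _) ((norm_nonneg _).trans h2.le)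
  rw [mink]
  linarith

lemma hdist_lt {X Y : Mink} (hX : X ∈ H3) (hY : Y ∈ H3) {r : ℝ} (hr : 0 ≤ r)
    (h : -mink X Y < Real.cosh r) : hdist X Y < r := by
  rw [hdist, ← Real.arcosh_cosh hr]
  exact (Real.arcosh_lt_arcosh (by linarith [one_le_neg_mink hX hY]) (Real.cosh_pos r)).2 h

lemma neg_mink_le_cosh {X Y : Mink} (hX : X ∈ H3) (hY : Y ∈ H3) {r : ℝ} (h : hdist X Y ≤ r) :
    -mink X Y ≤ Real.cosh r := by
  have h1 := one_le_neg_mink hX hY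
  rw [← Real.cosh_arcosh h1]
  exact Real.cosh_le_cosh.2 (abs_le_abs_of_nonneg (Real.arcosh_nonneg h1) h)

lemma hdist_comm (X Y : Mink) : hdist X Y = hdist Y X := by rw [hdist, hdist, mink_comm]

lemma fst_sq_eq {X : Mink} (hX : X ∈ H3) : X.1 ^ 2 = 1 + axisSq X + X.2 2 ^ 2 := by
  have := hX.1
  rw [mink_eq] at this
  rw [axisSq]
  linarith

lemma axisSq_nonneg (X : Mink) : 0 ≤ axisSq X := by unfold axisSq; positivity

lemma continuous_axisSq : Continuous axisSq := by
  have : ∀ i, Continuous fun X : Mink => X.2 i := fun i => (spaceCoord i).continuous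
  unfold axisSq
  exact ((this 0).pow 2).add ((this 1).pow 2)

/-! ### Surfaces of revolution -/

/-- The diffeomorphism of `ℝ³` onto a region of `ℝ³` that sends `S²` to the surface of revolution
with profile `ρ² = (A² - u²) G(u)`. -/
def revolve (A : ℝ) (G : ℝ → ℝ) (y : E3) : E3 :=
  !₂[A * √(G (A * y 2)) * y 0, A * √(G (A * y 2)) * y 1, A * y 2]

/-- The surface of revolution in `ℍ³` with profile `ρ² = (A² - u²) G(u)`. -/
def revSurface (A : ℝ) (G : ℝ → ℝ) (x : S2) : Mink := hlift (revolve A G x)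

/-- The function that is negative inside the surface of revolution and positive outside. -/
def revLevel (A : ℝ) (G : ℝ → ℝ) (X : Mink) : ℝ :=
  axisSq X - (A ^ 2 - X.2 2 ^ 2) * G (X.2 2)

section Revolution

variable {A : ℝ} {G : ℝ → ℝ}

lemma contDiff_revolve (hG : ContDiff ℝ ∞ G) (hGpos : ∀ u, 0 < G u) :
    ContDiff ℝ ∞ (revolve A G) := by
  have hy : ∀ i, ContDiff ℝ ∞ fun y : E3 => y i := fun i =>
    (EuclideanSpace.proj i : E3 →L[ℝ] ℝ).contDiff
  have hs : ContDiff ℝ ∞ fun y : E3 => √(G (A * y 2)) :=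
    (hG.comp (contDiff_const.mul (hy 2))).sqrt fun y => (hGpos _).ne'
  rw [contDiff_euclidean]
  intro i
  fin_cases i
  · exact (contDiff_const.mul hs).mul (hy 0)
  · exact (contDiff_const.mul hs).mul (hy 1)
  · exact contDiff_const.mul (hy 2)

/-- The left inverse of `revolve`. -/
def unrevolve (A : ℝ) (G : ℝ → ℝ) (X : Mink) : E3 :=
  !₂[X.2 0 / (A * √(G (X.2 2))), X.2 1 / (A * √(G (X.2 2))), X.2 2 / A]

lemma contDiff_unrevolve (hA : 0 < A) (hG : ContDiff ℝ ∞ G) (hGpos : ∀ u, 0 < G u) :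
    ContDiff ℝ ∞ (unrevolve A G) := by
  have hy : ∀ i, ContDiff ℝ ∞ fun X : Mink => X.2 i := fun i => (spaceCoord i).contDiff
  have hs : ContDiff ℝ ∞ fun X : Mink => √(G (X.2 2)) :=
    (hG.comp (hy 2)).sqrt fun y => (hGpos _).ne'
  have hne : ∀ X : Mink, A * √(G (X.2 2)) ≠ 0 := fun X =>
    (mul_pos hA (Real.sqrt_pos.2 (hGpos _))).ne'
  rw [contDiff_euclidean]
  intro i
  fin_cases i
  · exact (hy 0).div (contDiff_const.mul hs) hne
  · exact (hy 1).div (contDiff_const.mul hs) hne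
  · exact (hy 2).div contDiff_const fun _ => hA.ne'

lemma unrevolve_revSurface (hA : 0 < A) (hGpos : ∀ u, 0 < G u) (x : S2) :
    unrevolve A G (revSurface A G x) = x := by
  have h := (Real.sqrt_pos.2 (hGpos (A * (x : E3) 2))).ne'
  ext i
  fin_cases i <;> simp [unrevolve, revSurface, revolve] <;> field_simp

/-- `unrevolve` is a smooth left inverse, so injectivity of the map and of its differential are
inherited from the inclusion of `S²`. -/
lemma isSmoothEmbedding_revSurface (hA : 0 < A) (hG : ContDiff ℝ ∞ G) (hGpos : ∀ u, 0 < G u) :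
    IsSmoothEmbedding (revSurface A G) := by
  have hsm : ContMDiff (𝓡 2) 𝓘(ℝ, Mink) ∞ (revSurface A G) :=
    (contDiff_hlift.comp (contDiff_revolve hG hGpos)).contMDiff.comp contMDiff_coe_sphere
  refine ⟨⟨fun x => hlift_mem _, hsm, fun x => ?_⟩, fun x y hxy => ?_⟩
  · have h1 : ((↑) : S2 → E3) = unrevolve A G ∘ revSurface A G := by
      ext1 z
      exact (unrevolve_revSurface hA hGpos z).symm
    have h2 := injective_mvfderiv_subtypeVal_sphere (n := 2) x
    have h3 : mfderiv (𝓡 2) 𝓘(ℝ, E3) ((↑) : S2 → E3) x =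
        (mfderiv 𝓘(ℝ, Mink) 𝓘(ℝ, E3) (unrevolve A G) (revSurface A G x)).comp
          (mfderiv (𝓡 2) 𝓘(ℝ, Mink) (revSurface A G) x) := by
      conv_lhs => rw [h1]
      exact mfderiv_comp x
        ((contDiff_unrevolve hA hG hGpos).contMDiff.mdifferentiableAt (by simp))
        (hsm.mdifferentiableAt (by simp))
    intro v w hvw
    refine h2 ?_
    change mfderiv (𝓡 2) 𝓘(ℝ, E3) ((↑) : S2 → E3) x v
      = mfderiv (𝓡 2) 𝓘(ℝ, E3) ((↑) : S2 → E3) x w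
    rw [h3]
    exact congrArg (mfderiv 𝓘(ℝ, Mink) 𝓘(ℝ, E3) (unrevolve A G) (revSurface A G x)) hvw
  · ext1
    rw [← unrevolve_revSurface hA hGpos x, hxy, unrevolve_revSurface hA hGpos y]

lemma range_revSurface (hA : 0 < A) (hGpos : ∀ u, 0 < G u) :
    range (revSurface A G) = {X | X ∈ H3 ∧ revLevel A G X = 0} := by
  ext X
  constructor
  · rintro ⟨x, rfl⟩
    refine ⟨hlift_mem _, ?_⟩
    have hx : inner ℝ (x : E3) (x : E3) = (1 : ℝ) := by
      rw [real_inner_self_eq_norm_sq, norm_eq_of_mem_sphere, one_pow]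
    rw [inner_eq_three] at hx
    have hs := Real.sq_sqrt (hGpos (A * (x : E3) 2)).le
    simp only [revLevel, axisSq, revSurface, hlift_snd, revolve, PiLp.toLp_apply, Matrix.cons_val]
    linear_combination A ^ 2 * ((x : E3) 0 ^ 2 + (x : E3) 1 ^ 2) * hs
      + A ^ 2 * G (A * (x : E3) 2) * hx
  · rintro ⟨hX, hlev⟩
    have hg := Real.sqrt_pos.2 (hGpos (X.2 2))
    have hs := Real.sq_sqrt (hGpos (X.2 2)).le
    have hn : unrevolve A G X ∈ sphere (0 : E3) 1 := by
      rw [mem_sphere_zero_iff_norm, ← sq_eq_sq₀ (norm_nonneg _) zero_le_one,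
        ← real_inner_self_eq_norm_sq, inner_eq_three]
      simp only [unrevolve, PiLp.toLp_apply, Matrix.cons_val]
      rw [revLevel, axisSq, ← hs] at hlev
      field_simp
      linarith
    refine ⟨⟨_, hn⟩, (congrArg hlift ?_).trans (hlift_of_mem hX)⟩
    ext i
    have h2 : A * (X.2 2 / A) = X.2 2 := by field_simp
    fin_cases i <;> simp [revolve, unrevolve, h2] <;> field_simp

/-- Isometries of `ℍ³` fixing two points of the axis preserve surfaces of revolution. -/
lemma revolution_image {P Q : ℝ} (hP : P ≠ 0) (hQ : Q ≠ 0) (hA : 0 < A) (hGpos : ∀ u, 0 < G u)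
    (L : Mink ≃ₗ[ℝ] Mink) (hL : ∀ X Y, mink (L X) (L Y) = mink X Y)
    (hp : L (Q, !₂[0, 0, P]) = (Q, !₂[0, 0, P])) (hq : L (Q, !₂[0, 0, -P]) = (Q, !₂[0, 0, -P])) :
    L '' range (revSurface A G) = range (revSurface A G) := by
  rw [range_revSurface hA hGpos]
  have key : ∀ L : Mink ≃ₗ[ℝ] Mink, (∀ X Y, mink (L X) (L Y) = mink X Y) →
      L (Q, !₂[0, 0, P]) = (Q, !₂[0, 0, P]) → L (Q, !₂[0, 0, -P]) = (Q, !₂[0, 0, -P]) →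
      ∀ X ∈ {X | X ∈ H3 ∧ revLevel A G X = 0}, L X ∈ {X | X ∈ H3 ∧ revLevel A G X = 0} := by
    rintro L hL hp hq X ⟨hX, hlev⟩
    have h1 := hL X (Q, !₂[0, 0, P])
    have h2 := hL X (Q, !₂[0, 0, -P])
    have h3 := hL X X
    rw [hp] at h1
    rw [hq] at h2
    simp only [mink_eq, Matrix.cons_val] at h1 h2 h3
    -- The products with the two fixed points determine `X.1` and `X.2 2`; invariance of `⟨X, X⟩`
    -- then preserves `axisSq`.
    have h4 : (L X).1 = X.1 := mul_right_cancel₀ hQ (by linarith)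
    have h5 : (L X).2 2 = X.2 2 := mul_right_cancel₀ hP (by linarith)
    rw [h4, h5] at h3
    refine ⟨⟨(hL X X).trans hX.1, h4 ▸ hX.2⟩, ?_⟩
    rw [revLevel, axisSq] at hlev ⊢
    rw [h5]
    linarith
  refine Subset.antisymm (image_subset_iff.2 (key L hL hp hq)) fun X hX => ?_
  refine ⟨L.symm X, key L.symm (fun X Y => ?_) ?_ ?_ X hX, L.apply_symm_apply X⟩
  · rw [← hL, L.apply_symm_apply, L.apply_symm_apply]
  · rw [LinearEquiv.symm_apply_eq, hp]
  · rw [LinearEquiv.symm_apply_eq, hq]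

lemma continuous_revLevel (hG : Continuous G) : Continuous (revLevel A G) := by
  have h2 : Continuous fun X : Mink => X.2 2 := (spaceCoord 2).continuous
  exact continuous_axisSq.sub ((continuous_const.sub (h2.pow 2)).mul (hG.comp h2))

lemma sq_lt_of_revLevel_neg (hGpos : ∀ u, 0 < G u) {X : Mink} (h : revLevel A G X < 0) :
    X.2 2 ^ 2 < A ^ 2 := by
  rw [revLevel] at h
  have h1 := axisSq_nonneg X
  by_contra! hcon
  nlinarith [mul_nonneg (sub_nonneg.2 hcon) (hGpos (X.2 2)).le]

/-- The region enclosed by a surface of revolution. -/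
lemma enclosed_revSurface (hA : 0 < A) (hG : Continuous G) (hGpos : ∀ u, 0 < G u) :
    enclosed (range (revSurface A G)) = {X | X ∈ H3 ∧ revLevel A G X < 0} := by
  have hlc := continuous_revLevel (A := A) hG
  rw [range_revSurface hA hGpos]
  set M := {X | X ∈ H3 ∧ revLevel A G X = 0} with hM
  ext X
  constructor
  · rintro ⟨⟨hX, hXM⟩, R, hR⟩
    refine ⟨hX, ?_⟩
    by_contra! hcon
    have hpos : 0 < revLevel A G X := lt_of_le_of_ne hcon fun h => hXM ⟨hX, h.symm⟩
    -- An outer point escapes to infinity along the first space coordinate, with the sign that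
    -- increases `axisSq` and with `X.2 2` fixed; so `revLevel` stays positive along the path.
    obtain ⟨σ, hσ, hσX⟩ : ∃ σ : ℝ, σ ^ 2 = 1 ∧ 0 ≤ σ * X.2 0 := by
      rcases le_total 0 (X.2 0) with h | h
      · exact ⟨1, by norm_num, by linarith⟩
      · exact ⟨-1, by norm_num, by linarith⟩
    set γ : ℝ → Mink := fun s => hlift (X.2 + s • (σ • EuclideanSpace.single 0 1)) with hγ
    have hγc : Continuous γ := continuous_hlift.comp (by fun_prop)
    have hsub : γ '' Ici 0 ⊆ connectedComponentIn (H3 \ M) X := by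
      refine IsPreconnected.subset_connectedComponentIn
        (isPreconnected_Ici.image _ hγc.continuousOn) ⟨0, by simp, ?_⟩ ?_
      · simp [hγ, hlift_of_mem hX]
      · rintro _ ⟨s, hs, rfl⟩
        have hs : 0 ≤ s := hs
        refine ⟨hlift_mem _, fun hmem => ?_⟩
        have h1 : revLevel A G (γ s) = revLevel A G X + 2 * s * (σ * X.2 0) + s ^ 2 := by
          simp [revLevel, axisSq, hγ]
          linear_combination s ^ 2 * hσ
        have h2 := hmem.2
        have h3 : 0 ≤ 2 * s * (σ * X.2 0) := by positivity
        nlinarith [sq_nonneg s]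
    have hgap : 0 < X.1 - ‖X.2‖ := sub_pos.2 (norm_snd_lt_fst hX)
    -- Large enough that `-⟨X, γ s⟩` exceeds `cosh R`.
    set s := (Real.cosh R + 1) / (X.1 - ‖X.2‖) with hs
    have hs0 : 0 ≤ s := by have := Real.cosh_pos R; positivity
    have h1 := neg_mink_le_cosh hX (hlift_mem _) (hR (γ s) (hsub ⟨s, hs0, rfl⟩))
    have h2 := neg_mink_ge X (γ s)
    have h3 := norm_snd_lt_fst (hlift_mem (X.2 + s • (σ • EuclideanSpace.single 0 1)))
    have h4 : s ≤ (γ s).1 := by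
      refine le_trans ?_ h3.le
      refine le_trans ?_ (PiLp.norm_apply_le _ 0)
      refine abs_le_of_sq_le_sq' ?_ (norm_nonneg _) |>.2
      have h8 : 0 ≤ 2 * s * (σ * X.2 0) := by positivity
      have h9 : (X.2 0 + s * σ) ^ 2 = X.2 0 ^ 2 + 2 * s * (σ * X.2 0) + s ^ 2 := by
        linear_combination s ^ 2 * hσ
      simp only [hlift_snd, PiLp.add_apply, PiLp.smul_apply, smul_eq_mul,
        PiLp.single_apply, if_true, mul_one, Real.norm_eq_abs, sq_abs]
      rw [h9]
      nlinarith [sq_nonneg (X.2 0)]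
    have h5 : (X.1 - ‖X.2‖) * s = Real.cosh R + 1 := by rw [hs]; field_simp
    have h6 : 0 ≤ ‖X.2‖ * ((γ s).1 - ‖(γ s).2‖) := mul_nonneg (norm_nonneg _) (sub_pos.2 h3).le
    have h7 : (X.1 - ‖X.2‖) * s ≤ (X.1 - ‖X.2‖) * (γ s).1 := by gcongr
    linarith
  · rintro ⟨hX, hlev⟩
    have hXM : X ∈ H3 \ M := ⟨hX, fun h => hlev.ne h.2⟩
    refine ⟨hXM, ?_⟩
    have hcomp : connectedComponentIn (H3 \ M) X ⊆ {Y | revLevel A G Y < 0} := by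
      refine isPreconnected_connectedComponentIn.subset_left_of_subset_union
        (isOpen_lt hlc continuous_const) (isOpen_lt (continuous_const (y := (0 : ℝ))) hlc) ?_ ?_
        ⟨X, mem_connectedComponentIn hXM, hlev⟩
      · exact disjoint_left.2 fun Y h1 h2 => lt_asymm (show revLevel A G Y < 0 from h1) h2
      · intro Y hY
        obtain ⟨hY1, hY2⟩ := connectedComponentIn_subset _ _ hY
        rcases lt_trichotomy (revLevel A G Y) 0 with h | h | h
        · exact Or.inl h
        · exact (hY2 ⟨hY1, h⟩).elim
        · exact Or.inr h
    obtain ⟨K, hK⟩ := (isCompact_Icc (a := -A) (b := A)).exists_bound_of_continuousOn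
      (f := fun u => (A ^ 2 - u ^ 2) * G u) (by fun_prop)
    refine ⟨Real.arcosh (2 * X.1 * √(1 + K + A ^ 2)), fun Y hY => ?_⟩
    have hY3 := (connectedComponentIn_subset _ _ hY).1
    have hYl : revLevel A G Y < 0 := hcomp hY
    have h1 := sq_lt_of_revLevel_neg hGpos hYl
    have h2 := (le_abs_self _).trans (hK (Y.2 2) (abs_le.1 (abs_le_of_sq_le_sq h1.le hA.le)))
    have h3 : Y.1 ≤ √(1 + K + A ^ 2) := by
      refine Real.le_sqrt_of_sq_le ?_
      rw [fst_sq_eq hY3]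
      rw [revLevel] at hYl
      linarith
    have h4 := one_le_neg_mink hX hY3
    have h5 := neg_mink_le hX hY3
    have h6 : -mink X Y ≤ 2 * X.1 * √(1 + K + A ^ 2) := by
      refine h5.trans ?_
      have := hX.2
      gcongr
    rw [hdist]
    exact (Real.arcosh_le_arcosh (by linarith) (by linarith)).2 h6

/-- Seen from a point of the axis between its poles, a surface of revolution is homotopic to the
round sphere. -/
lemma homotopic_revSurface {c : ℝ} (hcA : |c| < A) (hG : ContDiff ℝ ∞ G) (hGpos : ∀ u, 0 < G u) :
    ∃ h : C(S2, E3x), sphereIncl.Homotopic h ∧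
      ∀ x, (h x : E3) = (revSurface A G x).2 - !₂[0, 0, c] := by
  obtain ⟨hc1, hc2⟩ := abs_lt.1 hcA
  have hA : 0 < A := (abs_nonneg c).trans_lt hcA
  set k : unitInterval × S2 → E3 := fun z =>
    (1 - (z.1 : ℝ)) • (z.2 : E3) + (z.1 : ℝ) • (revolve A G z.2 - !₂[0, 0, c]) with hk
  have hkc : Continuous k := by
    have := (contDiff_revolve (A := A) hG hGpos).continuous
    fun_prop
  -- The first two coordinates of `k` are those of `x` times a positive factor, so a zero forces `x`
  -- to be a pole; there the segment from `±1` to `±A - c` avoids `0` since `|c| < A`.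
  have hk0 : ∀ z, k z ≠ 0 := by
    rintro ⟨s, x⟩ h0
    obtain ⟨s, hs0, hs1⟩ := s
    have hx : inner ℝ (x : E3) (x : E3) = (1 : ℝ) := by
      rw [real_inner_self_eq_norm_sq, norm_eq_of_mem_sphere, one_pow]
    rw [inner_eq_three] at hx
    have hg := Real.sqrt_pos.2 (hGpos (A * (x : E3) 2))
    have e0 := congrArg (fun v : E3 => v 0) h0
    have e1 := congrArg (fun v : E3 => v 1) h0
    have e2 := congrArg (fun v : E3 => v 2) h0
    simp [hk, revolve] at e0 e1 e2
    have hfac : 0 < (1 - s) + s * (A * √(G (A * (x : E3) 2))) := by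
      rcases hs0.eq_or_lt with h | h
      · rw [← h]; norm_num
      · have : 0 ≤ 1 - s := by linarith
        positivity
    have x0 : (x : E3) 0 = 0 := by
      refine (mul_eq_zero.1 (?_ : ((1 - s) + s * (A * √(G (A * (x : E3) 2)))) * _ = 0)).resolve_left
        hfac.ne'
      linarith
    have x1 : (x : E3) 1 = 0 := by
      refine (mul_eq_zero.1 (?_ : ((1 - s) + s * (A * √(G (A * (x : E3) 2)))) * _ = 0)).resolve_left
        hfac.ne'
      linarith
    rw [x0, x1] at hx
    have : ((x : E3) 2 - 1) * ((x : E3) 2 + 1) = 0 := by linarith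
    rcases mul_eq_zero.1 this with h | h
    · have h' : (x : E3) 2 = 1 := by linarith
      rw [h'] at e2
      have h1 : 0 ≤ s * (A - c) := mul_nonneg hs0 (by linarith)
      have h2 : s = 1 := by linarith
      rw [h2] at e2
      linarith
    · have h' : (x : E3) 2 = -1 := by linarith
      rw [h'] at e2
      have h1 : 0 ≤ s * (A + c) := mul_nonneg hs0 (by linarith)
      have h2 : s = 1 := by linarith
      rw [h2] at e2
      linarith
  refine ⟨⟨fun x => ⟨k (1, x), hk0 _⟩, by fun_prop⟩, ⟨⟨⟨fun z => ⟨k z, hk0 z⟩, by fun_prop⟩, ?_, ?_⟩⟩, ?_⟩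
  · intro x
    ext1
    simp [hk, sphereIncl]
  · intro x
    rfl
  · intro x
    simp [hk, revSurface]

end Revolution

/-! ### The dumbbell profile -/

/-- A smooth function that vanishes for `u ≤ a` and equals `(u - a) / (A + u)` for `u ≥ b`. -/
def bulge (A a b u : ℝ) : ℝ := Real.smoothTransition ((u - a) / (b - a)) * ((u - a) / (A + u))

section Bulge

variable {A a b u : ℝ}

lemma bulge_eq_zero (hab : a < b) (hu : u ≤ a) : bulge A a b u = 0 := by
  rw [bulge, Real.smoothTransition.zero_of_nonpos, zero_mul]
  exact div_nonpos_of_nonpos_of_nonneg (by linarith) (by linarith)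

lemma bulge_eq (hab : a < b) (hu : b ≤ u) : bulge A a b u = (u - a) / (A + u) := by
  rw [bulge, Real.smoothTransition.one_of_one_le, one_mul]
  rw [one_le_div (by linarith)]
  linarith

lemma bulge_nonneg (hA : 0 < A) (ha : 0 < a) (hab : a < b) : 0 ≤ bulge A a b u := by
  rcases le_or_gt u a with h | h
  · rw [bulge_eq_zero hab h]
  · exact mul_nonneg (Real.smoothTransition.nonneg _)
      (div_nonneg (by linarith) (by linarith))

lemma bulge_le (hA : 0 < A) (ha : 0 < a) (hu : a ≤ u) : bulge A a b u ≤ (u - a) / (A + u) :=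
  mul_le_of_le_one_left (div_nonneg (by linarith) (by linarith)) (Real.smoothTransition.le_one _)

/-- The pole of the quotient at `u = -A` lies where the cut-off vanishes. -/
lemma contDiff_bulge (hA : 0 < A) (ha : 0 < a) (hab : a < b) : ContDiff ℝ ∞ (bulge A a b) := by
  rw [contDiff_iff_contDiffAt]
  intro u
  rcases lt_or_ge u a with h | h
  · have : bulge A a b =ᶠ[nhds u] fun _ => 0 := by
      filter_upwards [Iio_mem_nhds h] with v hv using bulge_eq_zero hab (le_of_lt hv)
    exact contDiffAt_const.congr_of_eventuallyEq this
  · have h1 : ContDiff ℝ ∞ fun u : ℝ => Real.smoothTransition ((u - a) / (b - a)) :=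
      Real.smoothTransition.contDiff.comp ((contDiff_id.sub contDiff_const).div_const _)
    have h2 : ContDiffAt ℝ ∞ (fun u : ℝ => (u - a) / (A + u)) u :=
      (contDiffAt_id.sub contDiffAt_const).div (contDiffAt_const.add contDiffAt_id)
        (by show A + u ≠ 0; linarith)
    exact h1.contDiffAt.mul h2

end Bulge

/-- The profile function of the dumbbell: two spherical caps joined by a thin neck. -/
def dumbbellProfile (η Q A a b u : ℝ) : ℝ := η + (bulge A a b u + bulge A a b (-u)) / Q ^ 2

section Profile

variable {η Q A a b : ℝ}

lemma dumbbellProfile_neg (u : ℝ) :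
    dumbbellProfile η Q A a b (-u) = dumbbellProfile η Q A a b u := by
  rw [dumbbellProfile, dumbbellProfile, neg_neg, add_comm (bulge A a b (-u))]

lemma dumbbellProfile_pos (hη : 0 < η) (hA : 0 < A) (ha : 0 < a) (hab : a < b) (u : ℝ) :
    0 < dumbbellProfile η Q A a b u := by
  have h1 := bulge_nonneg (u := u) hA ha hab
  have h2 := bulge_nonneg (u := -u) hA ha hab
  unfold dumbbellProfile
  positivity

lemma contDiff_dumbbellProfile (hA : 0 < A) (ha : 0 < a) (hab : a < b) :
    ContDiff ℝ ∞ (dumbbellProfile η Q A a b) := by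
  have h := contDiff_bulge hA ha hab
  exact contDiff_const.add ((h.add (h.comp contDiff_neg)).div_const _)

/-- On the neck. -/
lemma profile_neck_le (hη : 0 < η) (hab : a < b) {u : ℝ} (hu : |u| ≤ a) :
    (A ^ 2 - u ^ 2) * dumbbellProfile η Q A a b u ≤ A ^ 2 * η := by
  obtain ⟨h1, h2⟩ := abs_le.1 hu
  rw [dumbbellProfile, bulge_eq_zero hab h2, bulge_eq_zero hab (by linarith)]
  simp only [add_zero, zero_div]
  nlinarith [mul_nonneg (sq_nonneg u) hη.le]

/-- On the caps, from above. -/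
lemma profile_cap_le (hη : 0 < η) (hQ : 0 < Q) (hA : 0 < A) (ha : 0 < a) (hab : a < b) {u : ℝ}
    (hu : a ≤ u) (huA : u ≤ A) : Q ^ 2 * ((A ^ 2 - u ^ 2) * dumbbellProfile η Q A a b u)
      ≤ Q ^ 2 * (A ^ 2 * η) + (A - u) * (u - a) := by
  have h1 := bulge_le (b := b) hA ha hu
  have h2 : Q ^ 2 * ((A ^ 2 - u ^ 2) * dumbbellProfile η Q A a b u) =
      Q ^ 2 * ((A ^ 2 - u ^ 2) * η) + (A - u) * ((A + u) * bulge A a b u) := by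
    rw [dumbbellProfile, bulge_eq_zero (u := -u) hab (by linarith)]
    field_simp
    ring
  have h3 : (A + u) * bulge A a b u ≤ u - a := by
    rw [le_div_iff₀ (by linarith)] at h1
    linarith
  have h4 : (A - u) * ((A + u) * bulge A a b u) ≤ (A - u) * (u - a) :=
    mul_le_mul_of_nonneg_left h3 (by linarith)
  have h5 : Q ^ 2 * ((A ^ 2 - u ^ 2) * η) ≤ Q ^ 2 * (A ^ 2 * η) := by
    have := sq_nonneg u
    gcongr
    linarith
  linarith

/-- On the caps, from below. -/
lemma lt_profile_cap (hη : 0 < η) (hQ : 0 < Q) (hA : 0 < A) (ha : 0 < a) (hab : a < b) {u : ℝ}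
    (hu : b ≤ u) (huA : u < A) : (A - u) * (u - a) <
      Q ^ 2 * ((A ^ 2 - u ^ 2) * dumbbellProfile η Q A a b u) := by
  have h2 : Q ^ 2 * ((A ^ 2 - u ^ 2) * dumbbellProfile η Q A a b u) =
      Q ^ 2 * ((A ^ 2 - u ^ 2) * η) + (A - u) * (u - a) := by
    have : A + u ≠ 0 := by linarith
    rw [dumbbellProfile, bulge_eq_zero (u := -u) hab (by linarith), bulge_eq hab hu]
    field_simp
    ring
  have h3 : 0 < A ^ 2 - u ^ 2 := by nlinarith
  have h4 : 0 < Q ^ 2 * ((A ^ 2 - u ^ 2) * η) := by positivity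
  linarith

end Profile

/-! ### Geodesic balls centred on the axis -/

/-- The point of the axis with coordinates `(Q, 0, 0, P)`. -/
def axisPoint (Q P : ℝ) : Mink := (Q, !₂[0, 0, P])

lemma axisPoint_mem {Q P : ℝ} (hQ : 0 < Q) (hQP : Q ^ 2 = 1 + P ^ 2) : axisPoint Q P ∈ H3 := by
  refine ⟨?_, hQ⟩
  simp [mink_eq, axisPoint]
  linarith

lemma mink_axisPoint (X : Mink) (Q P : ℝ) :
    mink X (axisPoint Q P) = X.2 2 * P - X.1 * Q := by
  simp [mink_eq, axisPoint]

/-- The inequality is `X.1 * Q < c + P * X.2 2` squared, with `X.1 ^ 2 = 1 + axisSq X + X.2 2 ^ 2`;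
positivity of the right side allows taking roots. -/
lemma neg_mink_axisPoint_lt {X : Mink} (hX : X ∈ H3) {Q P c : ℝ} (hQP : Q ^ 2 = 1 + P ^ 2)
    (hc : 0 < c + P * X.2 2)
    (h : Q ^ 2 * axisSq X < c ^ 2 + 2 * c * (P * X.2 2) - X.2 2 ^ 2 - Q ^ 2) :
    -mink X (axisPoint Q P) < c := by
  have h1 := fst_sq_eq hX
  have h2 : (X.1 * Q) ^ 2 < (c + P * X.2 2) ^ 2 := by
    rw [mul_pow, h1]
    nlinarith
  have h3 := lt_of_pow_lt_pow_left₀ 2 hc.le h2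
  rw [mink_axisPoint]
  linarith

lemma axisSq_le_of_neg_mink_le {X : Mink} (hX : X ∈ H3) {Q P c : ℝ} (hQ : 0 < Q)
    (hQP : Q ^ 2 = 1 + P ^ 2) (h : -mink X (axisPoint Q P) ≤ c) :
    Q ^ 2 * axisSq X ≤ c ^ 2 + 2 * c * (P * X.2 2) - X.2 2 ^ 2 - Q ^ 2 := by
  have h1 := fst_sq_eq hX
  rw [mink_axisPoint] at h
  have h0 := hX.2
  have h2 : (X.1 * Q) ^ 2 ≤ (c + P * X.2 2) ^ 2 :=
    pow_le_pow_left₀ (by positivity) (by linarith) 2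
  rw [mul_pow, h1] at h2
  nlinarith

lemma neg_mink_axisPoint_cosh (x y : ℝ) :
    -mink (axisPoint (Real.cosh x) (Real.sinh x)) (axisPoint (Real.cosh y) (Real.sinh y))
      = Real.cosh (x - y) := by
  rw [mink_axisPoint, Real.cosh_sub]
  simp [axisPoint]

lemma hdist_axisPoint {x y : ℝ} (h : y ≤ x) :
    hdist (axisPoint (Real.cosh x) (Real.sinh x)) (axisPoint (Real.cosh y) (Real.sinh y))
      = x - y := by
  rw [hdist, neg_mink_axisPoint_cosh, Real.arcosh_cosh (by linarith)]

/-- Points close to the axis lie in a thin tube about a segment. -/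
lemma mem_htube {X : Mink} (hX : X ∈ H3) {ℓ ε : ℝ} (hε : 0 < ε)
    (h1 : axisSq X < Real.sinh ε ^ 2) (h2 : |X.2 2| ≤ Real.sinh ℓ) :
    X ∈ htube (axisPoint (Real.cosh ℓ) (Real.sinh ℓ))
      (axisPoint (Real.cosh (-ℓ)) (Real.sinh (-ℓ))) ε := by
  have h0 := axisSq_nonneg X
  -- `m` is `cosh` of the distance from `X` to the axis, and dividing the `(X.1, X.2 2)` part by `m`
  -- gives the nearest point of the axis.
  set m := √(1 + axisSq X) with hm
  have hm2 : m ^ 2 = 1 + axisSq X := Real.sq_sqrt (by linarith)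
  have hm1 : 1 ≤ m := by rw [hm, Real.one_le_sqrt]; linarith
  have hmp : 0 < m := by linarith
  set z := Real.arsinh (X.2 2 / m) with hz
  have hsz : Real.sinh z = X.2 2 / m := Real.sinh_arsinh _
  have hcz : Real.cosh z = X.1 / m := by
    rw [← sq_eq_sq₀ (Real.cosh_pos z).le (div_nonneg hX.2.le hmp.le), Real.cosh_sq, hsz, div_pow,
      div_pow, fst_sq_eq hX, ← hm2]
    field_simp
    ring
  have hzl : |Real.sinh z| ≤ Real.sinh ℓ := by
    rw [hsz, abs_div, abs_of_pos hmp]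
    exact (div_le_self (abs_nonneg _) hm1).trans h2
  obtain ⟨hz1, hz2⟩ := abs_le.1 hzl
  rw [← Real.sinh_neg, Real.sinh_le_sinh] at hz1
  rw [Real.sinh_le_sinh] at hz2
  have hZ : axisPoint (Real.cosh z) (Real.sinh z) ∈ H3 :=
    axisPoint_mem (Real.cosh_pos z) (by rw [Real.cosh_sq]; ring)
  refine ⟨hX, axisPoint (Real.cosh z) (Real.sinh z), ⟨hZ, ?_⟩, hdist_lt hX hZ hε.le ?_⟩
  · rw [hdist_axisPoint hz2, hdist_axisPoint hz1, hdist_axisPoint (hz1.trans hz2)]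
    ring
  · have : -mink X (axisPoint (Real.cosh z) (Real.sinh z)) = m := by
      rw [mink_axisPoint, hsz, hcz]
      have := fst_sq_eq hX
      field_simp
      linarith
    rw [this]
    refine lt_of_pow_lt_pow_left₀ 2 (Real.cosh_pos ε).le ?_
    rw [hm2, Real.cosh_sq]
    linarith

/-! ### The dumbbell -/

/-- On the geodesic sphere of radius `r` about the axis point at height `y`, the right side is
`cosh² y * axisSq`; the factors on the left display the two poles. This is why the caps are modelled
on `(A - u) (u - a)`. -/
lemma sinh_sub_mul_sinh_sub (y r u : ℝ) :
    (Real.sinh (y + r) - u) * (u - Real.sinh (y - r)) =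
      Real.cosh r ^ 2 + 2 * Real.cosh r * (Real.sinh y * u) - u ^ 2 - Real.cosh y ^ 2 := by
  have h1 := Real.cosh_sq r
  have h2 := Real.cosh_sq y
  rw [Real.sinh_add, Real.sinh_sub]
  linear_combination (Real.sinh r ^ 2 + 1) * h2
    + (-Real.sinh y ^ 2 - 1) * h1

lemma sub_mul_sub_le_sq (a b x : ℝ) : (b - x) * (x - a) ≤ ((b - a) / 2) ^ 2 := by
  nlinarith [sq_nonneg (b - x - (x - a))]

set_option maxHeartbeats 800000 in
/-- For two points of the axis that are far apart there is a dumbbell that lies inside the neck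
barrier. -/
theorem exists_dumbbell : ∃ ℓ₀ : ℝ, 0 ≤ ℓ₀ ∧ ∀ ℓ : ℝ, ℓ₀ ≤ ℓ → ∀ ε : ℝ, 0 < ε →
    ∃ (A : ℝ) (G : ℝ → ℝ), Real.sinh ℓ < A ∧ ContDiff ℝ ∞ G ∧ (∀ u, 0 < G u) ∧
      IsDumbbell (range (revSurface A G)) (axisPoint (Real.cosh ℓ) (Real.sinh ℓ))
        (axisPoint (Real.cosh ℓ) (-Real.sinh ℓ)) ε ∧
      (∀ x, neckBarrier (revSurface A G x) ≤ 1 / 32) ∧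
      ∀ τ : ℝ, (τ = 1 ∨ τ = -1) → ∀ x,
        Real.cosh 1 ≤ -mink (revSurface A G x) (axisPoint (Real.cosh ℓ) (τ * Real.sinh ℓ)) := by
  -- As `r ≤ 3/2` below, this gives `ℓ - r ≥ 2 sinh² r + 1`, so that on the caps `log (1 + u²) ≥ 2
  -- (ℓ - r - log 2) ≥ 4 sinh² r`.
  refine ⟨3 / 2 + (2 * Real.sinh (3 / 2) ^ 2 + 1), by positivity, fun ℓ hℓ ε hε => ?_⟩
  set e := min ε 1 with he
  have he0 : 0 < e := lt_min hε one_pos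
  have he1 : e ≤ 1 := min_le_right _ _
  have heε : e ≤ ε := min_le_left _ _
  -- The cap radius lies strictly between `1` and `1 + e`, leaving room for the unit ball inside and
  -- for the neck term outside.
  set r := 1 + e / 2 with hr
  have hrl : r + 1 ≤ ℓ := by nlinarith [sq_nonneg (Real.sinh (3 / 2))]
  set P := Real.sinh ℓ with hP
  set Q := Real.cosh ℓ with hQ
  have hQ0 : 0 < Q := Real.cosh_pos ℓ
  have hP0 : 0 < P := Real.sinh_pos_iff.2 (by linarith)
  have hQP : Q ^ 2 = 1 + P ^ 2 := by rw [hQ, Real.cosh_sq]; ring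
  set A := Real.sinh (ℓ + r) with hA
  set a := Real.sinh (ℓ - r) with ha
  set b := Real.sinh (ℓ - 1) with hb
  have ha0 : 0 < a := Real.sinh_pos_iff.2 (by linarith)
  have hab : a < b := Real.sinh_lt_sinh.2 (by linarith)
  have haP : a < P := Real.sinh_lt_sinh.2 (by linarith)
  have hPA : P < A := Real.sinh_lt_sinh.2 (by linarith)
  have hA0 : 0 < A := hP0.trans hPA
  have hc1 : Real.cosh 1 < Real.cosh r := by
    rw [Real.cosh_lt_cosh, abs_of_pos one_pos, abs_of_pos (by linarith)]
    linarith
  have hc2 : Real.cosh r < Real.cosh (1 + e) := by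
    rw [Real.cosh_lt_cosh, abs_of_pos (by linarith), abs_of_pos (by linarith)]
    linarith
  have hc0 : 0 < Real.cosh 1 := Real.cosh_pos 1
  have hse : 0 < Real.sinh e := Real.sinh_pos_iff.2 he0
  -- `κ` bounds `axisSq` on the neck. Its three bounds serve the initial neck barrier, the thin
  -- tube, and the inclusion of the caps in the balls of radius `1 + e`.
  set κ := min (1 / 32) (min (Real.sinh e ^ 2)
    ((Real.cosh (1 + e) ^ 2 - Real.cosh r ^ 2) / Q ^ 2)) with hκ
  have hκ0 : 0 < κ := by
    have : 0 < Real.cosh (1 + e) ^ 2 - Real.cosh r ^ 2 :=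
      sub_pos.2 (pow_lt_pow_left₀ hc2 (hc0.trans hc1).le two_ne_zero)
    refine lt_min (by norm_num) (lt_min (by positivity) (by positivity))
  have hκ1 : κ ≤ 1 / 32 := min_le_left _ _
  have hκ2 : κ ≤ Real.sinh e ^ 2 := (min_le_right _ _).trans (min_le_left _ _)
  have hκ3 : Q ^ 2 * κ ≤ Real.cosh (1 + e) ^ 2 - Real.cosh r ^ 2 := by
    have : κ ≤ (Real.cosh (1 + e) ^ 2 - Real.cosh r ^ 2) / Q ^ 2 :=
      (min_le_right _ _).trans (min_le_right _ _)
    rwa [le_div_iff₀ (by positivity), mul_comm] at this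
  set η := κ / A ^ 2 with hη
  have hη0 : 0 < η := by positivity
  have hAη : A ^ 2 * η = κ := by rw [hη]; field_simp
  set G := dumbbellProfile η Q A a b with hG
  have hGpos : ∀ u, 0 < G u := dumbbellProfile_pos hη0 hA0 ha0 hab
  have hGsm : ContDiff ℝ ∞ G := contDiff_dumbbellProfile hA0 ha0 hab
  have hGneg : ∀ τ : ℝ, (τ = 1 ∨ τ = -1) → ∀ u, (A ^ 2 - u ^ 2) * G u
      = (A ^ 2 - (τ * u) ^ 2) * G (τ * u) := by
    rintro τ (rfl | rfl) u
    · rw [one_mul]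
    · rw [neg_one_mul, hG, dumbbellProfile_neg, neg_sq]
  have hτQP : ∀ τ : ℝ, (τ = 1 ∨ τ = -1) → Q ^ 2 = 1 + (τ * P) ^ 2 := by
    rintro τ (rfl | rfl) <;> rw [hQP] <;> ring
  have hτsq : ∀ τ : ℝ, (τ = 1 ∨ τ = -1) → ∀ u : ℝ, (τ * u) ^ 2 = u ^ 2 := by
    rintro τ (rfl | rfl) u <;> ring
  have hprod : ∀ u, (A - u) * (u - a) =
      Real.cosh r ^ 2 + 2 * Real.cosh r * (P * u) - u ^ 2 - Q ^ 2 :=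
    sinh_sub_mul_sinh_sub ℓ r
  have hneck : ∀ u, |u| ≤ a → (A ^ 2 - u ^ 2) * G u ≤ κ := fun u hu => by
    rw [← hAη]
    exact profile_neck_le hη0 hab hu
  have hcap : ∀ u, a ≤ u → u ≤ A → Q ^ 2 * ((A ^ 2 - u ^ 2) * G u) ≤
      Q ^ 2 * κ + (A - u) * (u - a) := fun u hu huA => by
    rw [← hAη]
    exact profile_cap_le hη0 hQ0 hA0 ha0 hab hu huA
  -- the unit balls lie inside
  have hinside : ∀ τ : ℝ, (τ = 1 ∨ τ = -1) → ∀ X ∈ H3,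
      -mink X (axisPoint Q (τ * P)) ≤ Real.cosh 1 → revLevel A G X < 0 := by
    intro τ hτ X hX hle
    have h1 := axisSq_le_of_neg_mink_le hX hQ0 (hτQP τ hτ) hle
    set u := X.2 2 with hu
    have h2 : τ * P * u = P * (τ * u) := by ring
    rw [h2, ← hτsq τ hτ u] at h1
    have h3 := sinh_sub_mul_sinh_sub ℓ 1 (τ * u)
    rw [← h3] at h1
    have h4 : 0 ≤ Q ^ 2 * axisSq X := mul_nonneg (by positivity) (axisSq_nonneg X)
    have hmono : b < Real.sinh (ℓ + 1) := Real.sinh_lt_sinh.2 (by linarith)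
    have hmono2 : Real.sinh (ℓ + 1) < A := Real.sinh_lt_sinh.2 (by linarith)
    have h5 : b ≤ τ * u := by
      by_contra! hcon
      have := mul_neg_of_pos_of_neg (sub_pos.2 (hcon.trans hmono)) (sub_neg.2 hcon)
      linarith
    have h6 : τ * u ≤ Real.sinh (ℓ + 1) := by
      by_contra! hcon
      have := mul_neg_of_neg_of_pos (sub_neg.2 hcon) (sub_pos.2 (hmono.trans hcon))
      linarith
    have h7 := lt_profile_cap hη0 hQ0 hA0 ha0 hab h5 (h6.trans_lt hmono2)
    rw [← hG, ← hGneg τ hτ, hprod] at h7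
    rw [h3] at h1
    have h8 : 0 ≤ P * (τ * u) := mul_nonneg hP0.le (by linarith)
    have h9 : Q ^ 2 * axisSq X < Q ^ 2 * ((A ^ 2 - u ^ 2) * G u) := by
      have h10 : 0 < Real.cosh r ^ 2 - Real.cosh 1 ^ 2 :=
        sub_pos.2 (pow_lt_pow_left₀ hc1 hc0.le two_ne_zero)
      have h11 : 0 ≤ (Real.cosh r - Real.cosh 1) * (P * (τ * u)) :=
        mul_nonneg (by linarith) h8
      linarith
    have h10 := lt_of_mul_lt_mul_left h9 (by positivity)
    rw [revLevel]
    linarith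
  -- the caps lie in the larger balls
  have houtside : ∀ τ : ℝ, (τ = 1 ∨ τ = -1) → ∀ X ∈ H3, revLevel A G X < 0 → a ≤ τ * X.2 2 →
      -mink X (axisPoint Q (τ * P)) < Real.cosh (1 + e) := by
    intro τ hτ X hX hlev hau
    have hsq := sq_lt_of_revLevel_neg hGpos hlev
    rw [← hτsq τ hτ] at hsq
    have huA : τ * X.2 2 ≤ A := (abs_le_of_sq_le_sq' hsq.le hA0.le).2
    have h1 := hcap _ hau huA
    rw [← hGneg τ hτ, hprod] at h1
    have h2 : P * (τ * X.2 2) = τ * P * X.2 2 := by ring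
    have h8 : 0 ≤ P * (τ * X.2 2) := mul_nonneg hP0.le (ha0.le.trans hau)
    refine neg_mink_axisPoint_lt hX (hτQP τ hτ) ?_ ?_
    · rw [← h2]
      linarith
    · rw [revLevel] at hlev
      have h3 : Q ^ 2 * axisSq X < Q ^ 2 * ((A ^ 2 - X.2 2 ^ 2) * G (X.2 2)) := by
        gcongr
        linarith
      have h11 : 0 ≤ (Real.cosh (1 + e) - Real.cosh r) * (P * (τ * X.2 2)) :=
        mul_nonneg (by linarith) h8
      rw [hτsq τ hτ] at h1
      rw [← h2]
      linarith
  have hpP : ∀ τ : ℝ, (τ = 1 ∨ τ = -1) → axisPoint Q (τ * P) ∈ H3 := fun τ hτ =>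
    axisPoint_mem hQ0 (hτQP τ hτ)
  have henc := enclosed_revSurface (A := A) (G := G) hA0 hGsm.continuous hGpos
  have hunit : ∀ τ : ℝ, (τ = 1 ∨ τ = -1) →
      hclosedBall (axisPoint Q (τ * P)) 1 ⊆ enclosed (range (revSurface A G)) := by
    rintro τ hτ X ⟨hX, hd⟩
    rw [henc]
    refine ⟨hX, hinside τ hτ X hX (neg_mink_le_cosh hX (hpP τ hτ) ?_)⟩
    rwa [hdist_comm]
  have hballε : ∀ τ : ℝ, (τ = 1 ∨ τ = -1) → ∀ X ∈ H3, revLevel A G X < 0 → a ≤ τ * X.2 2 →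
      X ∈ hball (axisPoint Q (τ * P)) (1 + ε) := by
    intro τ hτ X hX hlev hau
    refine ⟨hX, ?_⟩
    rw [hdist_comm]
    refine (hdist_lt hX (hpP τ hτ) (by linarith) (houtside τ hτ X hX hlev hau)).trans_le ?_
    linarith
  refine ⟨A, G, hPA, hGsm, hGpos, ⟨?_, ?_, ?_, ?_⟩, ?_, ?_⟩
  · simpa using hunit 1 (Or.inl rfl)
  · simpa using hunit (-1) (Or.inr rfl)
  · rw [henc]
    rintro X ⟨hX, hlev⟩
    rcases le_or_gt (|X.2 2|) a with h | h
    · right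
      have h1 := hneck _ h
      rw [revLevel] at hlev
      have h2 : Real.sinh e ^ 2 ≤ Real.sinh ε ^ 2 :=
        pow_le_pow_left₀ hse.le (Real.sinh_le_sinh.2 heε) 2
      have := mem_htube hX hε (by linarith) (h.trans haP.le : |X.2 2| ≤ Real.sinh ℓ)
      rwa [Real.cosh_neg, Real.sinh_neg] at this
    · left
      rcases lt_abs.1 h with h' | h'
      · left
        simpa using hballε 1 (Or.inl rfl) X hX hlev (by linarith)
      · right
        simpa using hballε (-1) (Or.inr rfl) X hX hlev (by linarith)
  · intro L hL hp hq
    exact revolution_image hP0.ne' hQ0.ne' hA0 hGpos L hL hp hq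
  · intro x
    have hx : revSurface A G x ∈ range (revSurface A G) := mem_range_self x
    rw [range_revSurface hA0 hGpos] at hx
    obtain ⟨hX, hlev⟩ := hx
    set X := revSurface A G x
    set u := X.2 2 with hu
    rw [revLevel] at hlev
    have hlog0 : 0 ≤ Real.log (1 + u ^ 2) := Real.log_nonneg (by nlinarith [sq_nonneg u])
    rw [neckBarrier]
    rcases le_or_gt (|u|) a with h | h
    · have h1 := hneck _ h
      linarith
    · have hlogu : 4 * Real.sinh r ^ 2 ≤ Real.log (1 + u ^ 2) := by
        have h1 : Real.log (Real.cosh (ℓ - r) ^ 2) ≤ Real.log (1 + u ^ 2) := by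
          refine Real.log_le_log (by have := Real.cosh_pos (ℓ - r); positivity) ?_
          rw [Real.cosh_sq, ← sq_abs u]
          nlinarith
        have h2 : ℓ - r - Real.log 2 ≤ Real.log (Real.cosh (ℓ - r)) := by
          rw [← Real.log_exp (ℓ - r), ← Real.log_div (Real.exp_pos _).ne' two_ne_zero,
            Real.log_exp]
          refine Real.log_le_log (by positivity) ?_
          rw [Real.cosh_eq]
          have := Real.exp_pos (-(ℓ - r))
          linarith
        have h3 : Real.log 2 < 1 := by have := Real.log_two_lt_d9; linarith
        rw [Real.log_pow] at h1
        have h4 : Real.sinh r ^ 2 ≤ Real.sinh (3 / 2) ^ 2 :=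
          pow_le_pow_left₀ (Real.sinh_nonneg_iff.2 (by linarith))
            (Real.sinh_le_sinh.2 (by linarith)) 2
        push_cast at h1
        linarith
      obtain ⟨τ, hτ, hτu⟩ : ∃ τ : ℝ, (τ = 1 ∨ τ = -1) ∧ |u| = τ * u := by
        rcases abs_choice u with h' | h'
        · exact ⟨1, Or.inl rfl, by rw [h', one_mul]⟩
        · exact ⟨-1, Or.inr rfl, by rw [h', neg_one_mul]⟩
      rw [hτu] at h
      have hsq : (τ * u) ^ 2 ≤ A ^ 2 := by
        rw [hτsq τ hτ]
        by_contra! hcon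
        have h1 := axisSq_nonneg X
        have h2 := mul_neg_of_neg_of_pos (sub_neg.2 hcon) (hGpos u)
        linarith
      have h1 := hcap _ h.le (abs_le_of_sq_le_sq' hsq hA0.le).2
      rw [← hGneg τ hτ] at h1
      -- The parabola is at most the square of half the distance of its zeros, so `axisSq ≤ κ +
      -- sinh² r` on the caps; the logarithm absorbs `sinh² r`.
      have h2 : (A - τ * u) * (τ * u - a) ≤ Q ^ 2 * Real.sinh r ^ 2 := by
        have : A - a = 2 * (Q * Real.sinh r) := by
          rw [hA, ha, Real.sinh_add, Real.sinh_sub]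
          ring
        refine (sub_mul_sub_le_sq a A _).trans_eq ?_
        rw [this]
        ring
      have h3 : Q ^ 2 * axisSq X ≤ Q ^ 2 * (κ + Real.sinh r ^ 2) := by
        rw [show axisSq X = (A ^ 2 - u ^ 2) * G u by linarith]
        linarith
      have h4 := le_of_mul_le_mul_left h3 (by positivity)
      linarith
  · intro τ hτ x
    have hx : revSurface A G x ∈ range (revSurface A G) := mem_range_self x
    rw [range_revSurface hA0 hGpos] at hx
    by_contra! hcon
    exact (hinside τ hτ _ hx.1 hcon.le).ne hx.2

section

/-! ### The neck pinches before the balls disappear -/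

instance preconnectedSpace_S2 : PreconnectedSpace S2 :=
  Subtype.preconnectedSpace (isPreconnected_sphere (by
    rw [← Module.finrank_eq_rank]
    simp) 0 1)

variable {F₀ : S2 → Mink} {F : ℝ → S2 → Mink} {T : ℝ}

/-- As long as the flow stays away from a neighbourhood of `p`, it meets every ray that starts in
this neighbourhood. -/
theorem IsMCF.exists_mem_ray (hF : IsMCF F₀ F T) {p : E3} {h : C(S2, E3x)}
    (hh : sphereIncl.Homotopic h) (hh0 : ∀ x, (h x : E3) = (F₀ x).2 - p) {t : ℝ}
    (ht : t ∈ Ico 0 T) {v : E3}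
    (hne : ∀ s ∈ Icc 0 t, ∀ x, ∀ r ∈ Icc (0 : ℝ) 1, (F s x).2 ≠ p + r • v) {e : E3} (he : e ≠ 0) :
    ∃ x, ∃ s : ℝ, 0 < s ∧ (F t x).2 = p + v + s • e := by
  -- The homotopy runs the flow up to time `t` and simultaneously moves the base point from `p` to
  -- `p + v`.
  set k : unitInterval × S2 → E3 := fun z =>
    (F ((z.1 : ℝ) * t) z.2).2 - (p + (z.1 : ℝ) • v) with hk
  have hmem : ∀ s : unitInterval, (s : ℝ) * t ∈ Icc 0 t := fun s =>
    ⟨mul_nonneg s.2.1 ht.1, mul_le_of_le_one_left ht.1 s.2.2⟩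
  have hFc : Continuous fun z : unitInterval × S2 => F ((z.1 : ℝ) * t) z.2 := by
    have h1 : Continuous fun z : unitInterval × S2 => (((z.1 : ℝ) * t, z.2) : ℝ × S2) := by
      fun_prop
    exact hF.continuousOn.comp_continuous h1 fun z =>
      ⟨⟨(hmem z.1).1, (hmem z.1).2.trans_lt ht.2⟩, mem_univ _⟩
  have hkc : Continuous k := (continuous_snd.comp hFc).sub (by fun_prop)
  have hk0 : ∀ z, k z ≠ 0 := fun z => sub_ne_zero.2 (hne _ (hmem z.1) _ _ z.1.2)
  set h' : C(S2, E3x) := ⟨fun x => ⟨k (1, x), hk0 _⟩, by fun_prop⟩ with hh'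
  have hhom : h.Homotopic h' := by
    refine ⟨⟨⟨fun z => ⟨k z, hk0 z⟩, by fun_prop⟩, fun x => ?_, fun x => rfl⟩⟩
    ext1
    simp [hk, hF.initial, hh0]
  obtain ⟨x, s, hs, hxs⟩ := exists_mem_ray_of_homotopic (hh.trans hhom) he
  refine ⟨x, s, hs, ?_⟩
  have : (F t x).2 - (p + v) = s • e := by simpa [hh', hk] using hxs
  rw [← this]
  abel

/-- For a short time the flow stays away from balls in the initial domain. -/
lemma IsMCF.neg_mink_ge (hF : IsMCF F₀ F T) {p : Mink}
    (h0 : ∀ x, Real.cosh 1 ≤ -mink (F₀ x) p) {t : ℝ} (ht : t ∈ Ico 0 T) (ht4 : t ≤ 1 / 4)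
    (x : S2) : 9 / 8 ≤ -mink (F t x) p := by
  have h1 := hF.exp_mul_mink_le p (K := -Real.cosh 1) (fun x => by linarith [h0 x]) ht x
  have h2 : (3 : ℝ) / 2 ≤ Real.cosh 1 := by
    rw [Real.cosh_eq]
    linarith [Real.exp_one_gt_d9, Real.exp_neg_one_gt_d9]
  -- `e⁻ᵗ ≥ 1 - t ≥ 3/4`, and `3/2 * 3/4 = 9/8`.
  have h3 : Real.exp t * (3 / 4) ≤ 1 := by
    have h4 := Real.add_one_le_exp (-t)
    calc Real.exp t * (3 / 4) ≤ Real.exp t * Real.exp (-t) := by gcongr; linarith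
      _ = 1 := by rw [← Real.exp_add]; simp
  have h5 := Real.exp_pos t
  by_contra! hcon
  nlinarith

lemma snd_ne_of_neg_mink_ge {X : Mink} (hX : X ∈ H3) {p : Mink} (h : 9 / 8 ≤ -mink X p) {v : E3}
    (hv : -mink (hlift v) p < 9 / 8) : X.2 ≠ v := by
  rintro rfl
  rw [hlift_of_mem hX] at hv
  linarith

end

end

/-! ### Assembling the barriers, the ray argument and the area bound -/

theorem theorem6p1 :
    ∃ d₀ : ℝ, ∀ d : ℝ, d₀ ≤ d → ∀ ε : ℝ, 0 < ε →
      ∃ (p q : Mink) (F₀ : S2 → Mink),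
        p ∈ H3 ∧ q ∈ H3 ∧ hdist p q = d ∧
        IsSmoothEmbedding F₀ ∧ IsDumbbell (Set.range F₀) p q ε ∧
        ∃ T₁ c : ℝ, 0 < c ∧
          ∀ (T : ℝ) (F : ℝ → S2 → Mink), 0 < T → IsMCF F₀ F T →
            T ≤ T₁ ∧ ∀ t ∈ Set.Ico 0 T, c ≤ area (F t) := by
  obtain ⟨ℓ₀, hℓ₀, hdumb⟩ := exists_dumbbell
  refine ⟨2 * ℓ₀, fun d hd ε hε => ?_⟩
  set ℓ := d / 2 with hℓ
  obtain ⟨A, G, hPA, hGsm, hGpos, hdb, hneck, havoid⟩ := hdumb ℓ (by linarith) ε hε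
  set P := Real.sinh ℓ with hP
  set Q := Real.cosh ℓ with hQ
  have hQ0 : 0 < Q := Real.cosh_pos ℓ
  have hP0 : 0 ≤ P := Real.sinh_nonneg_iff.2 (by linarith)
  have hQP : Q ^ 2 = 1 + P ^ 2 := by rw [hQ, Real.cosh_sq]; ring
  have hA0 : 0 < A := hP0.trans_lt hPA
  have hQP' : ∀ τ : ℝ, (τ = 1 ∨ τ = -1) → Q ^ 2 = 1 + (τ * P) ^ 2 := by
    rintro τ (rfl | rfl) <;> rw [hQP] <;> ring
  set F₀ := revSurface A G with hF₀
  have hp : axisPoint Q P ∈ H3 := axisPoint_mem hQ0 hQP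
  have hq : axisPoint Q (-P) ∈ H3 := axisPoint_mem hQ0 (by rw [neg_sq]; exact hQP)
  have hpmem : ∀ τ : ℝ, (τ = 1 ∨ τ = -1) → axisPoint Q (τ * P) ∈ H3 := fun τ hτ =>
    axisPoint_mem hQ0 (hQP' τ hτ)
  have hdist : hdist (axisPoint Q P) (axisPoint Q (-P)) = d := by
    have := hdist_axisPoint (x := ℓ) (y := -ℓ) (by linarith)
    rw [Real.cosh_neg, Real.sinh_neg] at this
    rw [this]
    linarith
  have hemb : IsSmoothEmbedding F₀ := isSmoothEmbedding_revSurface hA0 hGsm hGpos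
  have hone : ∀ τ : ℝ, (τ = 1 ∨ τ = -1) →
      -mink (hlift (axisPoint Q (τ * P)).2) (axisPoint Q (τ * P)) < 9 / 8 := fun τ hτ => by
    rw [hlift_of_mem (hpmem τ hτ), (hpmem τ hτ).1]
    norm_num
  -- a neighbourhood of the left point that the flow does not enter
  obtain ⟨δ, hδ, hδp⟩ : ∃ δ > 0, ∀ v : E3, ‖v‖ < δ →
      -mink (hlift ((axisPoint Q P).2 + v)) (axisPoint Q P) < 9 / 8 := by
    have hc : Continuous fun v : E3 =>
        -mink (hlift ((axisPoint Q P).2 + v)) (axisPoint Q P) := by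
      have h1 : Continuous fun X => mink X (axisPoint Q P) :=
        continuous_iff_continuousAt.2 fun X => (hasFDerivAt_mink_left _ X).continuousAt
      exact (h1.comp (continuous_hlift.comp (by fun_prop))).neg
    have h0 := hone 1 (Or.inl rfl)
    rw [one_mul] at h0
    obtain ⟨δ, hδ, hsub⟩ := Metric.isOpen_iff.1 (isOpen_lt hc continuous_const) 0
      (by simpa using h0)
    exact ⟨δ, hδ, fun v hv => hsub (by simpa using hv)⟩
  obtain ⟨K, hK⟩ : ∃ K, ∀ x, (F₀ x).1 ≤ K := by
    have hc : Continuous fun x => (F₀ x).1 :=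
      continuous_fst.comp hemb.smooth.continuous
    obtain ⟨K, hK⟩ := (isCompact_range hc).bddAbove
    exact ⟨K, fun x => hK ⟨x, rfl⟩⟩
  have hK0 : 0 < K := (hemb.mem (radial 0)).2.trans_le (hK _)
  -- Only the first two coordinates concern the disc about the axis; `3/4` is the middle of the
  -- range of radii in `area_ge_of_projection`.
  set a : E3 := !₂[0, 0, 3 / 4] with ha
  set δ' := min δ (1 / 4) with hδ'
  have hδ'0 : 0 < δ' := lt_min hδ (by norm_num)
  -- `1/8` is the time in which a barrier starting at `1/32` and falling at speed `1/4` reaches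
  -- zero.
  refine ⟨axisPoint Q P, axisPoint Q (-P), F₀, hp, hq, hdist, hemb, hdb, 1 / 8,
    volume.real (ball a δ') / (4 * K), ?_, fun T F hT hF => ?_⟩
  · have : 0 < volume.real (ball a δ') :=
      ENNReal.toReal_pos (measure_ball_pos volume _ hδ'0).ne' measure_ball_lt_top.ne
    positivity
  have haway : ∀ τ : ℝ, (τ = 1 ∨ τ = -1) → ∀ t ∈ Ico 0 T, t ≤ 1 / 4 → ∀ x,
      9 / 8 ≤ -mink (F t x) (axisPoint Q (τ * P)) := fun τ hτ t ht ht4 x =>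
    hF.neg_mink_ge (havoid τ hτ) ht ht4 x
  have hhom : ∀ τ : ℝ, (τ = 1 ∨ τ = -1) → ∃ h : C(S2, E3x), sphereIncl.Homotopic h ∧
      ∀ x, (h x : E3) = (F₀ x).2 - (axisPoint Q (τ * P)).2 := fun τ hτ => by
    refine homotopic_revSurface ?_ hGsm hGpos
    rcases hτ with rfl | rfl <;> simpa [abs_of_nonneg hP0] using hPA
  -- The ray from each centre along the axis, pointing away from the other centre, meets the
  -- surface.
  have hside : ∀ τ : ℝ, (τ = 1 ∨ τ = -1) → ∀ t ∈ Ico 0 T, t ≤ 1 / 4 →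
      ∃ x, 0 < τ * (F t x).2 2 := by
    intro τ hτ t ht ht4
    obtain ⟨h, hh, hh0⟩ := hhom τ hτ
    have hτ2 : τ * τ = 1 := by rcases hτ with rfl | rfl <;> norm_num
    have hτ0 : τ ≠ 0 := by rintro rfl; simp at hτ2
    obtain ⟨x, s, hs, hxs⟩ := hF.exists_mem_ray (v := 0) (e := τ • EuclideanSpace.single 2 1)
      hh hh0 ht (fun s hs x r _ => by
        rw [smul_zero, add_zero]
        exact snd_ne_of_neg_mink_ge ((hF.immersion s ⟨hs.1, hs.2.trans_lt ht.2⟩).mem x)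
          (haway τ hτ s ⟨hs.1, hs.2.trans_lt ht.2⟩ (hs.2.trans ht4) x) (hone τ hτ))
      (by simpa using hτ0)
    refine ⟨x, ?_⟩
    rw [hxs]
    simp [axisPoint]
    nlinarith
  have hT1 : T ≤ 1 / 8 := by
    by_contra! hcon
    obtain ⟨t, ht1, ht2⟩ := exists_between (lt_min hcon (show (1 / 8 : ℝ) < 1 / 4 by norm_num))
    have htT : t ∈ Ico 0 T := ⟨by linarith, ht2.trans_le (min_le_left _ _)⟩
    have ht4 : t ≤ 1 / 4 := (ht2.trans_le (min_le_right _ _)).le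
    obtain ⟨x, hx⟩ := hside 1 (Or.inl rfl) t htT ht4
    obtain ⟨y, hy⟩ := hside (-1) (Or.inr rfl) t htT ht4
    have hc : Continuous fun x => (F t x).2 2 :=
      (spaceCoord 2).continuous.comp (hF.immersion t htT).smooth.continuous
    obtain ⟨z, hz⟩ := mem_range_of_exists_le_of_exists_ge hc
      ⟨y, by linarith⟩ ⟨x, show 0 ≤ (F t x).2 2 by linarith⟩
    have hz : (F t z).2 2 = 0 := hz
    have h1 := hF.neckBarrier_le hneck htT z
    have h2 := axisSq_nonneg (F t z)
    rw [neckBarrier, hz] at h1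
    simp at h1
    linarith
  refine ⟨hT1, fun t ht => ?_⟩
  have ht4 : t ≤ 1 / 4 := by linarith [ht.2]
  refine area_ge_of_projection (hF.immersion t ht) (fun x => ?_) (min_le_right _ _) (by simp [ha])
    fun z hz => ?_
  -- The time coordinate is itself a linear function, so its initial bound persists; it controls the
  -- distortion of the projection.
  · have hv : ∀ X : Mink, mink X (-1, 0) = X.1 := fun X => by simp [mink]
    have h1 := hF.exp_mul_mink_le (-1, 0) (K := K) (fun x => by rw [hv]; exact hK x) ht x
    rw [hv] at h1
    have h2 := Real.one_le_exp ht.1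
    have h3 := ((hF.immersion t ht).mem x).2
    nlinarith
  · obtain ⟨h, hh, hh0⟩ := hhom 1 (Or.inl rfl)
    rw [one_mul] at hh0
    -- Moving along this ray changes only the third coordinate, so the point found projects to the
    -- first two coordinates of `z`.
    obtain ⟨x, s, hs, hxs⟩ := hF.exists_mem_ray (v := z - a) (e := EuclideanSpace.single 2 1)
      hh hh0 ht (fun s hs x r hr => by
        have h1 := haway 1 (Or.inl rfl) s ⟨hs.1, hs.2.trans_lt ht.2⟩ (hs.2.trans ht4) x
        rw [one_mul] at h1
        refine snd_ne_of_neg_mink_ge ((hF.immersion s ⟨hs.1, hs.2.trans_lt ht.2⟩).mem x) h1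
          (hδp _ ?_)
        rw [norm_smul, Real.norm_of_nonneg hr.1]
        calc r * ‖z - a‖ ≤ 1 * ‖z - a‖ := by gcongr; exact hr.2
          _ < δ := by rw [one_mul]; exact hz.trans_le (min_le_left _ _))
      (by simp)
    refine ⟨x, ?_, ?_⟩ <;> rw [hxs] <;> simp [axisPoint, ha]
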